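/- Let $k$ be a field and let $A$, $B$ be metabelian Lie algebras over $k$, i.e. Lie algebras satisfying $(a\circ b)\circ(c\circ d)=0$; products are written $a\circ b$ or $ab$, and $A^2$ is the ideal generated by all products of two elements. Let $X=\{x_i\mid i\in I\}$ and $Y=\{y_j\mid j\in J\}$ be linear bases of $A/A^2$ and $B/B^2$, indexed by totally ordered sets; the same letters denote fixed preimages in $A$ and $B$. Put $R_X=k[X]$, $R_Y=k[Y]$, $R=k[X\cup Y]$ (polynomial rings). $A^2$ is an $R_X$-module and $B^2$ an $R_Y$-module, where a variable acts by right multiplication by the corresponding element. The metabelian product $A\ast B$ is the metabelian Lie algebra generated by $A$ and $B$ subject to the relations holding in $A$ and those holding in $B$ (the coproduct of $A$ and $B$ in the variety of metabelian Lie $k$-algebras), and $(A\ast B)^2$ is an $R$-module in the same way, via the images of $X\cup Y$. Let $M_1=A^2\otimes_{R_X}R$, $M_2=B^2\otimes_{R_Y}R$, and let $M_0$ be the ideal of $R$ generated by all $x_iy_j$ ($i\in I$, $j\in J$). Let $A^2=\langle Z_1\mid R_1\rangle$ and $B^2=\langle Z_2\mid R_2\rangle$ be any presentations of these modules over $R_X$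 and $R_Y$. Let $M$ be the $R$-module with generators $w_{ij}$ ($i\in I$, $j\in J$) and $Z_1\cup Z_2$, and with relations $R_1\cup R_2$ together with $$w_{ij_1}\cdot y_{j_2}=w_{ij_2}\cdot y_{j_1}+(y_{j_2}y_{j_1})\cdot x_i\quad(j_1>j_2),\qquad w_{i_1j}\cdot x_{i_2}=w_{i_2j}\cdot x_{i_1}+(x_{i_1}x_{i_2})\cdot y_j\quad(i_1>i_2),$$ where $y_{j_2}y_{j_1}\in B^2$ and $x_{i_1}x_{i_2}\in A^2$ are written in terms of $Z_2$ and $Z_1$. Let $V$ be the $k$-space with basis $X\cup Y$, and let $C=V\oplus M$ with $$(v_1,m_1)\circ(v_2,m_2)=(0,\;v_1v_2-m_2\cdot v_1+m_1\cdot v_2),$$ where $V\times V\to M$, $(v_1,v_2)\mapsto v_1v_2$, is the bilinear map that sends $(x_i,x_{i'})$ and $(y_j,y_{j'})$ to the images in $M$ of the products in $A^2$ and $B^2$, $(x_i,y_j)$ to $w_{ij}$ and $(y_j,x_i)$ to $-w_{ij}$. Then $C$ is a metabelian Lie algebra. Let $\psi:A\ast B\to C$ be the natural homomorphism: it sends the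 elements $x_i$, $y_j$ to the corresponding basis vectors of $V$, and the elements of $A^2$ and $B^2$ to their images in $M$. Let $U(C)=\{(0,m)\mid m\in M\}$. Then $\psi$ is an isomorphism. It maps $(A\ast B)^2$ onto $U(C)$ and induces an isomorphism of $R$-modules $(A\ast B)^2\cong M$. The $R$-submodule of $(A\ast B)^2$ generated by $A^2$ is isomorphic to $M_1$, by an isomorphism that identifies each $a\in A^2$ with $a\otimes1$, and the $R$-submodule generated by $B^2$ is likewise isomorphic to $M_2$. The sum of these two submodules is direct, and the quotient of $(A\ast B)^2$ by it is isomorphic to $M_0$, the class of $x_i\circ y_j$ corresponding to $x_iy_j$. -/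

import Mathlib

open scoped TensorProduct

noncomputable section

namespace MetabelianLie

/-! ### Metabelian Lie algebras and their commutants -/

/-- A Lie algebra is metabelian if it satisfies the identity `(a ∘ b) ∘ (c ∘ d) = 0`. -/
class IsMetabelian (L : Type*) [LieRing L] : Prop where
  lie_lie_lie_lie : ∀ a b c d : L, ⁅⁅a, b⁆, ⁅c, d⁆⁆ = 0

/-- The commutant `L²`: the ideal generated by all products `a ∘ b`. -/
abbrev commutant (k L : Type*) [CommRing k] [LieRing L] [LieAlgebra k L] : LieIdeal k L :=
  ⁅(⊤ : LieIdeal k L), (⊤ : LieIdeal k L)⁆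

section Action

variable {k L : Type*} [Field k] [LieRing L] [LieAlgebra k L]

lemma lie_mem_commutant (a b : L) : ⁅a, b⁆ ∈ commutant k L :=
  LieSubmodule.lie_mem_lie (LieSubmodule.mem_top a) (LieSubmodule.mem_top b)

lemma commutant_induction {p : L → Prop} (h0 : p 0) (hadd : ∀ a b, p a → p b → p (a + b))
    (hsmul : ∀ (c : k) a, p a → p (c • a)) (hlie : ∀ a b : L, p ⁅a, b⁆) {m : L}
    (hm : m ∈ commutant k L) : p m := by
  have hm' : m ∈ LieSubmodule.toSubmodule (commutant k L) := hm
  rw [LieSubmodule.lieIdeal_oper_eq_linear_span'] at hm'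
  induction hm' using Submodule.span_induction with
  | mem m h => obtain ⟨a, -, b, -, rfl⟩ := h; exact hlie a b
  | zero => exact h0
  | add a b _ _ ha hb =>
    refine hadd a b (ha ?_) (hb ?_) <;>
    · rw [← LieSubmodule.mem_toSubmodule, LieSubmodule.lieIdeal_oper_eq_linear_span']; assumption
  | smul c a _ ha =>
    refine hsmul c a (ha ?_)
    rw [← LieSubmodule.mem_toSubmodule, LieSubmodule.lieIdeal_oper_eq_linear_span']; assumption

lemma lie_eq_zero_of_mem_commutant [IsMetabelian L] {m n : L} (hm : m ∈ commutant k L)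
    (hn : n ∈ commutant k L) : ⁅m, n⁆ = 0 := by
  refine commutant_induction (k := k) (p := fun m => ⁅m, n⁆ = 0) (by simp)
    (fun a b ha hb => by rw [add_lie, ha, hb, add_zero])
    (fun c a ha => by rw [smul_lie, ha, smul_zero]) (fun a b => ?_) hm
  exact commutant_induction (k := k) (p := fun n => ⁅⁅a, b⁆, n⁆ = 0) (by simp)
    (fun a b ha hb => by rw [lie_add, ha, hb, add_zero])
    (fun c a ha => by rw [lie_smul, ha, smul_zero])
    (fun c d => IsMetabelian.lie_lie_lie_lie a b c d) hn

/-- Right multiplication `m ↦ m ∘ b` on the commutant. -/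
def rightMul (k : Type*) {L : Type*} [Field k] [LieRing L] [LieAlgebra k L] (b : L) :
    Module.End k (commutant k L) where
  toFun m := ⟨⁅(m : L), b⁆, lie_mem_commutant _ _⟩
  map_add' m n := Subtype.ext (by simp)
  map_smul' c m := Subtype.ext (by simp)

lemma rightMul_comm [IsMetabelian L] (a b : L) :
    rightMul k a * rightMul k b = rightMul k b * rightMul k a := by
  ext m
  change ⁅⁅(m : L), b⁆, a⁆ = ⁅⁅(m : L), a⁆, b⁆
  have h : ⁅(m : L), ⁅b, a⁆⁆ = 0 := lie_eq_zero_of_mem_commutant m.2 (lie_mem_commutant b a)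
  rw [leibniz_lie, ← lie_skew b ⁅(m : L), a⁆] at h
  exact add_neg_eq_zero.mp h

open scoped IsMulCommutative in
/-- For a family `z` in a metabelian Lie algebra `L`, the action of the polynomial ring on the
commutant in which the variable `z_i` acts by `m ↦ m ∘ z i`. -/
def polyAction [IsMetabelian L] {ι : Type*} (z : ι → L) :
    MvPolynomial ι k →ₐ[k] Module.End k (commutant k L) :=
  haveI : IsMulCommutative (Algebra.adjoin k (Set.range fun i => rightMul k (z i))) :=
    Algebra.isMulCommutative_adjoin k (by
      rintro _ ⟨i, rfl⟩ _ ⟨j, rfl⟩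
      exact rightMul_comm _ _)
  (Algebra.adjoin k (Set.range fun i => rightMul k (z i))).val.comp
    (MvPolynomial.aeval fun i =>
      (⟨rightMul k (z i), Algebra.subset_adjoin ⟨i, rfl⟩⟩ :
        Algebra.adjoin k (Set.range fun i => rightMul k (z i))))

lemma polyAction_X [IsMetabelian L] {ι : Type*} (z : ι → L) (i : ι) :
    polyAction (k := k) z (MvPolynomial.X i) = rightMul k (z i) := by
  simp [polyAction]

/-- The commutant `L²`, considered as a module over the polynomial ring `k[ι]` through the
family `z : ι → L`. -/
def CommutantModule (k : Type*) {L : Type*} [Field k] [LieRing L] [LieAlgebra k L]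
    {ι : Type*} (_z : ι → L) : Type _ :=
  commutant k L

variable {ι : Type*} (z : ι → L)

instance : AddCommGroup (CommutantModule k z) :=
  inferInstanceAs (AddCommGroup (commutant k L))

instance [IsMetabelian L] : Module (MvPolynomial ι k) (CommutantModule k z) :=
  letI : Module (Module.End k (commutant k L)) (CommutantModule k z) :=
    inferInstanceAs (Module (Module.End k (commutant k L)) (commutant k L))
  Module.compHom _ (polyAction (k := k) z).toRingHom

/-- An element of the commutant, as an element of the module. -/
def CommutantModule.mk (a : L) (ha : a ∈ commutant k L) : CommutantModule k z := ⟨a, ha⟩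

/-- The element of the Lie algebra underlying an element of the module. -/
def CommutantModule.val {z : ι → L} (d : CommutantModule k z) : L := Subtype.val d

variable {z}

@[ext] lemma CommutantModule.ext {d e : CommutantModule k z} (h : d.val = e.val) : d = e :=
  Subtype.ext h

lemma CommutantModule.val_mem (d : CommutantModule k z) : d.val ∈ commutant k L := d.2

lemma CommutantModule.val_add (d e : CommutantModule k z) : (d + e).val = d.val + e.val := rfl

lemma CommutantModule.val_X_smul [IsMetabelian L] (i : ι) (d : CommutantModule k z) :
    ((MvPolynomial.X i : MvPolynomial ι k) • d).val = ⁅d.val, z i⁆ := by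
  change (polyAction (k := k) z (MvPolynomial.X i) d : L) = _
  rw [polyAction_X]; rfl

lemma CommutantModule.val_C_smul [IsMetabelian L] (c : k) (d : CommutantModule k z) :
    ((MvPolynomial.C c : MvPolynomial ι k) • d).val = c • d.val := by
  change (polyAction (k := k) z (algebraMap k _ c) d : L) = _
  rw [AlgHom.commutes]; rfl

end Action

/-! ### The metabelian product -/

section Product

variable (k A B : Type*) [Field k] [LieRing A] [LieAlgebra k A] [LieRing B] [LieAlgebra k B]

/-- The generator of the free Lie algebra given by an element of `A`. -/
abbrev genA (a : A) : FreeLieAlgebra k (A ⊕ B) := FreeLieAlgebra.of k (Sum.inl a)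

/-- The generator of the free Lie algebra given by an element of `B`. -/
abbrev genB (b : B) : FreeLieAlgebra k (A ⊕ B) := FreeLieAlgebra.of k (Sum.inr b)

/-- The relations of the metabelian product: the generators are the elements of `A` and of `B`,
subject to all relations that hold in `A`, all relations that hold in `B`, and the metabelian
identity. -/
inductive ProductRel : FreeLieAlgebra k (A ⊕ B) → Prop
  | addA (a a' : A) :
      ProductRel (genA k A B (a + a') - (genA k A B a + genA k A B a'))
  | smulA (c : k) (a : A) :
      ProductRel (genA k A B (c • a) - c • genA k A B a)
  | lieA (a a' : A) :
      ProductRel (genA k A B ⁅a, a'⁆ - ⁅genA k A B a, genA k A B a'⁆)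
  | addB (b b' : B) :
      ProductRel (genB k A B (b + b') - (genB k A B b + genB k A B b'))
  | smulB (c : k) (b : B) :
      ProductRel (genB k A B (c • b) - c • genB k A B b)
  | lieB (b b' : B) :
      ProductRel (genB k A B ⁅b, b'⁆ - ⁅genB k A B b, genB k A B b'⁆)
  | metabelian (p q r s : FreeLieAlgebra k (A ⊕ B)) : ProductRel ⁅⁅p, q⁆, ⁅r, s⁆⁆

/-- The ideal generated by the relations of the metabelian product. -/
def productIdeal : LieIdeal k (FreeLieAlgebra k (A ⊕ B)) :=
  LieSubmodule.lieSpan k _ {r | ProductRel k A B r}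

/-- The metabelian product `A ∗ B`. -/
def MetabelianProduct : Type _ := FreeLieAlgebra k (A ⊕ B) ⧸ productIdeal k A B

namespace MetabelianProduct

instance : LieRing (MetabelianProduct k A B) :=
  inferInstanceAs (LieRing (FreeLieAlgebra k (A ⊕ B) ⧸ productIdeal k A B))

instance : LieAlgebra k (MetabelianProduct k A B) :=
  inferInstanceAs (LieAlgebra k (FreeLieAlgebra k (A ⊕ B) ⧸ productIdeal k A B))

/-- The quotient map. -/
def proj : FreeLieAlgebra k (A ⊕ B) →ₗ⁅k⁆ MetabelianProduct k A B where
  toLinearMap := (productIdeal k A B).toSubmodule.mkQ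
  map_lie' := rfl

lemma proj_surjective : Function.Surjective (proj k A B) := Submodule.mkQ_surjective _

variable {k A B}

lemma proj_eq_zero {r : FreeLieAlgebra k (A ⊕ B)} (h : ProductRel k A B r) :
    proj k A B r = 0 :=
  (Submodule.Quotient.mk_eq_zero _).mpr (LieSubmodule.subset_lieSpan h)

instance : IsMetabelian (MetabelianProduct k A B) where
  lie_lie_lie_lie a b c d := by
    obtain ⟨a, rfl⟩ := proj_surjective k A B a
    obtain ⟨b, rfl⟩ := proj_surjective k A B b
    obtain ⟨c, rfl⟩ := proj_surjective k A B c
    obtain ⟨d, rfl⟩ := proj_surjective k A B d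
    simp only [← LieHom.map_lie]
    exact proj_eq_zero (.metabelian a b c d)

variable (k A B)

/-- The canonical homomorphism `i_A : A → A ∗ B`. -/
def inA : A →ₗ⁅k⁆ MetabelianProduct k A B where
  toFun a := proj k A B (genA k A B a)
  map_add' a a' := by
    rw [← map_add, ← sub_eq_zero, ← map_sub]; exact proj_eq_zero (.addA a a')
  map_smul' c a := by
    rw [RingHom.id_apply, ← map_smul, ← sub_eq_zero, ← map_sub]
    exact proj_eq_zero (.smulA c a)
  map_lie' {a a'} := by
    rw [← LieHom.map_lie, ← sub_eq_zero, ← map_sub]; exact proj_eq_zero (.lieA a a')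

/-- The canonical homomorphism `i_B : B → A ∗ B`. -/
def inB : B →ₗ⁅k⁆ MetabelianProduct k A B where
  toFun b := proj k A B (genB k A B b)
  map_add' a a' := by
    rw [← map_add, ← sub_eq_zero, ← map_sub]; exact proj_eq_zero (.addB a a')
  map_smul' c a := by
    rw [RingHom.id_apply, ← map_smul, ← sub_eq_zero, ← map_sub]
    exact proj_eq_zero (.smulB c a)
  map_lie' {a a'} := by
    rw [← LieHom.map_lie, ← sub_eq_zero, ← map_sub]; exact proj_eq_zero (.lieB a a')

variable {k A B}
variable {H : Type*} [LieRing H] [LieAlgebra k H]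

/-- The universal property of the metabelian product: existence. -/
def lift [IsMetabelian H] (f : A →ₗ⁅k⁆ H) (g : B →ₗ⁅k⁆ H) :
    MetabelianProduct k A B →ₗ⁅k⁆ H :=
  let F : FreeLieAlgebra k (A ⊕ B) →ₗ⁅k⁆ H := FreeLieAlgebra.lift k (Sum.elim f g)
  have hF : productIdeal k A B ≤ F.ker := by
    refine LieSubmodule.lieSpan_le.mpr ?_
    intro r hr
    change F r = 0
    cases hr with
    | metabelian p q r s => simp only [LieHom.map_lie]; exact IsMetabelian.lie_lie_lie_lie _ _ _ _
    | _ => simp [F, FreeLieAlgebra.lift_of_apply]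
  { toLinearMap := (productIdeal k A B).toSubmodule.liftQ (F : FreeLieAlgebra k (A ⊕ B) →ₗ[k] H)
      (fun r hr => hF hr)
    map_lie' := by
      intro a b
      obtain ⟨a, rfl⟩ := proj_surjective k A B a
      obtain ⟨b, rfl⟩ := proj_surjective k A B b
      exact F.map_lie a b }

lemma lift_inA [IsMetabelian H] (f : A →ₗ⁅k⁆ H) (g : B →ₗ⁅k⁆ H) (a : A) :
    lift f g (inA k A B a) = f a :=
  FreeLieAlgebra.lift_of_apply (Sum.elim f g) (Sum.inl a)

lemma lift_inB [IsMetabelian H] (f : A →ₗ⁅k⁆ H) (g : B →ₗ⁅k⁆ H) (b : B) :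
    lift f g (inB k A B b) = g b :=
  FreeLieAlgebra.lift_of_apply (Sum.elim f g) (Sum.inr b)

/-- The universal property of the metabelian product: uniqueness. -/
lemma hom_ext {f g : MetabelianProduct k A B →ₗ⁅k⁆ H}
    (hA : ∀ a, f (inA k A B a) = g (inA k A B a))
    (hB : ∀ b, f (inB k A B b) = g (inB k A B b)) : f = g := by
  have h : f.comp (proj k A B) = g.comp (proj k A B) := by
    apply FreeLieAlgebra.hom_ext
    rintro (a | b)
    · exact hA a
    · exact hB b
  ext p
  obtain ⟨p, rfl⟩ := proj_surjective k A B p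
  exact LieHom.congr_fun h p

end MetabelianProduct

end Product

/-! ### The module `M` -/

/-- A linear basis of `L / L²`, together with fixed preimages in `L` of the basis elements. -/
structure LiftedBasis (ι k L : Type*) [Field k] [LieRing L] [LieAlgebra k L] where
  /-- the basis of `L / L²` -/
  basis : Module.Basis ι k (L ⧸ commutant k L)
  /-- the preimages -/
  elt : ι → L
  mk_elt : ∀ i, (LieSubmodule.Quotient.mk (elt i) : L ⧸ commutant k L) = basis i

/-- Extension of scalars along a ring homomorphism. -/
def ExtendScalars {R S : Type*} [CommRing R] [CommRing S] (f : R →+* S) (N : Type*)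
    [AddCommGroup N] [Module R N] : Type _ :=
  letI := f.toAlgebra
  S ⊗[R] N

namespace ExtendScalars

variable {R S : Type*} [CommRing R] [CommRing S] (f : R →+* S) (N : Type*)
    [AddCommGroup N] [Module R N]

instance : AddCommGroup (ExtendScalars f N) :=
  letI := f.toAlgebra
  (inferInstance : AddCommGroup (S ⊗[R] N))

instance : Module S (ExtendScalars f N) :=
  letI := f.toAlgebra
  (inferInstance : Module S (S ⊗[R] N))

variable {N}

/-- The element `1 ⊗ n`. -/
def of (n : N) : ExtendScalars f N :=
  letI := f.toAlgebra
  (1 : S) ⊗ₜ[R] n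

end ExtendScalars

/-- The inclusion `k[X] → k[X ∪ Y]`. -/
abbrev inclX (k I J : Type*) [Field k] : MvPolynomial I k →+* MvPolynomial (I ⊕ J) k :=
  (MvPolynomial.rename Sum.inl : MvPolynomial I k →ₐ[k] MvPolynomial (I ⊕ J) k).toRingHom

/-- The inclusion `k[Y] → k[X ∪ Y]`. -/
abbrev inclY (k I J : Type*) [Field k] : MvPolynomial J k →+* MvPolynomial (I ⊕ J) k :=
  (MvPolynomial.rename Sum.inr : MvPolynomial J k →ₐ[k] MvPolynomial (I ⊕ J) k).toRingHom

/-- The ideal `M₀` of `k[X ∪ Y]` generated by the products `x_i y_j`. -/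
def M₀ (k I J : Type*) [Field k] : Ideal (MvPolynomial (I ⊕ J) k) :=
  Ideal.span (Set.range fun p : I × J =>
    (MvPolynomial.X (Sum.inl p.1) * MvPolynomial.X (Sum.inr p.2) : MvPolynomial (I ⊕ J) k))

lemma mem_M₀ (k : Type*) {I J : Type*} [Field k] (i : I) (j : J) :
    (MvPolynomial.X (Sum.inl i) * MvPolynomial.X (Sum.inr j) : MvPolynomial (I ⊕ J) k) ∈
      M₀ k I J :=
  Ideal.subset_span ⟨(i, j), rfl⟩

/-- The generators of `M`: the symbols `w_ij = x_i y_j`, and the set `Z₁ ∪ Z₂`. -/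
inductive Gen (I J Z₁ Z₂ : Type*)
  | w (i : I) (j : J)
  | z₁ (g : Z₁)
  | z₂ (g : Z₂)

/-- Indices of the relations of `M`: the set `R₁ ∪ R₂ ∪ S`. -/
inductive RelIdx (I J R₁ R₂ : Type*) [LinearOrder I] [LinearOrder J]
  | r₁ (r : R₁)
  | r₂ (r : R₂)
  | sY (i : I) (j₁ j₂ : J) (h : j₂ < j₁)
  | sX (i₁ i₂ : I) (j : J) (h : i₂ < i₁)

/-- The embedding of `V` in `k[X ∪ Y]` as the space of linear forms. -/
def linForm (k I J : Type*) [Field k] : (I ⊕ J →₀ k) →ₗ[k] MvPolynomial (I ⊕ J) k :=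
  Finsupp.linearCombination k MvPolynomial.X

lemma linForm_single {k I J : Type*} [Field k] (s : I ⊕ J) (a : k) :
    linForm k I J (Finsupp.single s a) = a • MvPolynomial.X s := by
  simp [linForm]

section ModuleM

variable {k A B I J : Type*} [Field k]
  [LieRing A] [LieAlgebra k A] [IsMetabelian A] [LieRing B] [LieAlgebra k B] [IsMetabelian B]
  [LinearOrder I] [LinearOrder J]

/-- A word in the generators of a presentation of a module that represents a given element. -/
def word {R N : Type*} [CommRing R] [AddCommGroup N] [Module R N]
    (P : Module.Presentation R N) (n : N) : P.G →₀ R :=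
  (P.surjective_π n).choose

lemma π_word {R N : Type*} [CommRing R] [AddCommGroup N] [Module R N]
    (P : Module.Presentation R N) (n : N) : P.π (word P n) = n :=
  (P.surjective_π n).choose_spec

/-- The product `a ∘ b` as an element of the commutant module. -/
def lieElt {L ι : Type*} [LieRing L] [LieAlgebra k L] (z : ι → L) (a b : L) :
    CommutantModule k z :=
  CommutantModule.mk z ⁅a, b⁆ (lie_mem_commutant a b)

variable {x : I → A} {y : J → B}
  (P₁ : Module.Presentation (MvPolynomial I k) (CommutantModule k x))
  (P₂ : Module.Presentation (MvPolynomial J k) (CommutantModule k y))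

/-- The word `f` in the generators `Z₁` over `k[X]`, as a word in the generators of `M`
over `k[X ∪ Y]`. -/
def embX (f : P₁.G →₀ MvPolynomial I k) : Gen I J P₁.G P₂.G →₀ MvPolynomial (I ⊕ J) k :=
  (f.mapRange (inclX k I J) (map_zero _)).mapDomain Gen.z₁

/-- The word `f` in the generators `Z₂` over `k[Y]`, as a word in the generators of `M`
over `k[X ∪ Y]`. -/
def embY (f : P₂.G →₀ MvPolynomial J k) : Gen I J P₁.G P₂.G →₀ MvPolynomial (I ⊕ J) k :=
  (f.mapRange (inclY k I J) (map_zero _)).mapDomain Gen.z₂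

/-- The generators and relations of `M`, with respect to presentations `⟨Z₁ | R₁⟩` of `A²`
and `⟨Z₂ | R₂⟩` of `B²`. -/
def relM : Module.Relations (MvPolynomial (I ⊕ J) k) where
  G := Gen I J P₁.G P₂.G
  R := RelIdx I J P₁.R P₂.R
  relation
    | .r₁ r => embX P₁ P₂ (P₁.relation r)
    | .r₂ r => embY P₁ P₂ (P₂.relation r)
    | .sY i j₁ j₂ _ =>
        Finsupp.single (Gen.w i j₁) (MvPolynomial.X (Sum.inr j₂)) -
          (Finsupp.single (Gen.w i j₂) (MvPolynomial.X (Sum.inr j₁)) +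
            (MvPolynomial.X (Sum.inl i) : MvPolynomial (I ⊕ J) k) •
              embY P₁ P₂ (word P₂ (lieElt y (y j₂) (y j₁))))
    | .sX i₁ i₂ j _ =>
        Finsupp.single (Gen.w i₁ j) (MvPolynomial.X (Sum.inl i₂)) -
          (Finsupp.single (Gen.w i₂ j) (MvPolynomial.X (Sum.inl i₁)) +
            (MvPolynomial.X (Sum.inr j) : MvPolynomial (I ⊕ J) k) •
              embX P₁ P₂ (word P₁ (lieElt x (x i₁) (x i₂))))

/-- The `k[X ∪ Y]`-module `M = ⟨XY ∪ Z | R₁ ∪ R₂ ∪ S⟩`. -/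
def ModM : Type _ := (relM P₁ P₂).Quotient

instance : AddCommGroup (ModM P₁ P₂) := inferInstanceAs (AddCommGroup (relM P₁ P₂).Quotient)

instance : Module (MvPolynomial (I ⊕ J) k) (ModM P₁ P₂) :=
  inferInstanceAs (Module (MvPolynomial (I ⊕ J) k) (relM P₁ P₂).Quotient)

instance : Module k (ModM P₁ P₂) :=
  Module.compHom _ (algebraMap k (MvPolynomial (I ⊕ J) k))

instance : IsScalarTower k (MvPolynomial (I ⊕ J) k) (ModM P₁ P₂) :=
  IsScalarTower.of_algebraMap_smul fun _ _ => rfl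

/-- The class in `M` of a word in the generators. -/
def toM : (Gen I J P₁.G P₂.G →₀ MvPolynomial (I ⊕ J) k) →ₗ[MvPolynomial (I ⊕ J) k]
    ModM P₁ P₂ :=
  (relM P₁ P₂).toQuotient

lemma toM_relation (r : RelIdx I J P₁.R P₂.R) : toM P₁ P₂ ((relM P₁ P₂).relation r) = 0 :=
  (relM P₁ P₂).toQuotient_relation r

/-- The generator `w_ij` of `M`. -/
def wM (i : I) (j : J) : ModM P₁ P₂ := toM P₁ P₂ (Finsupp.single (Gen.w i j) 1)

/-- The natural map `A² → M`, semilinear along `k[X] → k[X ∪ Y]`: it sends each element of `Z₁`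
to the generator of `M` of the same name. -/
def ιA : CommutantModule k x →ₛₗ[inclX k I J] ModM P₁ P₂ :=
  letI : Module (MvPolynomial I k) (ModM P₁ P₂) := Module.compHom _ (inclX k I J)
  let s : P₁.Solution (ModM P₁ P₂) :=
    { var := fun g => toM P₁ P₂ (Finsupp.single (Gen.z₁ g) 1)
      linearCombination_var_relation := fun r => by
        refine Eq.trans ?_ (toM_relation P₁ P₂ (.r₁ r))
        change _ = toM P₁ P₂ (embX P₁ P₂ (P₁.relation r))
        induction P₁.relation r using Finsupp.induction_linear with
        | zero => simp [embX]
        | add f g hf hg =>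
          rw [map_add, hf, hg, ← map_add]
          congr 1
          simp only [embX]
          rw [Finsupp.mapRange_add (map_add _), Finsupp.mapDomain_add]
        | single g a =>
          rw [Finsupp.linearCombination_single]
          change inclX k I J a • (toM P₁ P₂ (Finsupp.single (Gen.z₁ g) 1)) = _
          rw [← map_smul]
          congr 1
          simp [embX] }
  { toFun := P₁.toIsPresentation.desc s
    map_add' := map_add _
    map_smul' := fun a d => map_smul (P₁.toIsPresentation.desc s) a d }

/-- The natural map `B² → M`, semilinear along `k[Y] → k[X ∪ Y]`: it sends each element of `Z₂`
to the generator of `M` of the same name. -/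
def ιB : CommutantModule k y →ₛₗ[inclY k I J] ModM P₁ P₂ :=
  letI : Module (MvPolynomial J k) (ModM P₁ P₂) := Module.compHom _ (inclY k I J)
  let s : P₂.Solution (ModM P₁ P₂) :=
    { var := fun g => toM P₁ P₂ (Finsupp.single (Gen.z₂ g) 1)
      linearCombination_var_relation := fun r => by
        refine Eq.trans ?_ (toM_relation P₁ P₂ (.r₂ r))
        change _ = toM P₁ P₂ (embY P₁ P₂ (P₂.relation r))
        induction P₂.relation r using Finsupp.induction_linear with
        | zero => simp [embY]
        | add f g hf hg =>
          rw [map_add, hf, hg, ← map_add]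
          congr 1
          simp only [embY]
          rw [Finsupp.mapRange_add (map_add _), Finsupp.mapDomain_add]
        | single g a =>
          rw [Finsupp.linearCombination_single]
          change inclY k I J a • (toM P₁ P₂ (Finsupp.single (Gen.z₂ g) 1)) = _
          rw [← map_smul]
          congr 1
          simp [embY] }
  { toFun := P₂.toIsPresentation.desc s
    map_add' := map_add _
    map_smul' := fun a d => map_smul (P₂.toIsPresentation.desc s) a d }

lemma C_smul (c : k) (m : ModM P₁ P₂) :
    (MvPolynomial.C c : MvPolynomial (I ⊕ J) k) • m = c • m := rfl

lemma ιA_X_smul (i : I) (d : CommutantModule k x) :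
    ιA P₁ P₂ ((MvPolynomial.X i : MvPolynomial I k) • d) =
      (MvPolynomial.X (Sum.inl i) : MvPolynomial (I ⊕ J) k) • ιA P₁ P₂ d := by
  rw [map_smulₛₗ]; simp

lemma ιB_X_smul (j : J) (d : CommutantModule k y) :
    ιB P₁ P₂ ((MvPolynomial.X j : MvPolynomial J k) • d) =
      (MvPolynomial.X (Sum.inr j) : MvPolynomial (I ⊕ J) k) • ιB P₁ P₂ d := by
  rw [map_smulₛₗ]; simp

lemma ιA_C_smul (c : k) (d : CommutantModule k x) :
    ιA P₁ P₂ ((MvPolynomial.C c : MvPolynomial I k) • d) = c • ιA P₁ P₂ d := by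
  rw [map_smulₛₗ, ← C_smul]; simp

lemma ιB_C_smul (c : k) (d : CommutantModule k y) :
    ιB P₁ P₂ ((MvPolynomial.C c : MvPolynomial J k) • d) = c • ιB P₁ P₂ d := by
  rw [map_smulₛₗ, ← C_smul]; simp

lemma ιA_var (g : P₁.G) : ιA P₁ P₂ (P₁.var g) = toM P₁ P₂ (Finsupp.single (Gen.z₁ g) 1) := by
  let _ : Module (MvPolynomial I k) (ModM P₁ P₂) := Module.compHom _ (inclX k I J)
  exact P₁.toIsPresentation.desc_var _ g

lemma ιB_var (g : P₂.G) : ιB P₁ P₂ (P₂.var g) = toM P₁ P₂ (Finsupp.single (Gen.z₂ g) 1) := by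
  let _ : Module (MvPolynomial J k) (ModM P₁ P₂) := Module.compHom _ (inclY k I J)
  exact P₂.toIsPresentation.desc_var _ g

lemma toM_embX (f : P₁.G →₀ MvPolynomial I k) :
    toM P₁ P₂ (embX P₁ P₂ f) = ιA P₁ P₂ (P₁.π f) := by
  induction f using Finsupp.induction_linear with
  | zero => rw [map_zero, map_zero]; simp [embX]
  | add f g hf hg =>
    rw [map_add, map_add, ← hf, ← hg, ← map_add]
    congr 1
    simp only [embX]
    rw [Finsupp.mapRange_add (map_add _), Finsupp.mapDomain_add]
  | single g a =>
    have h : Finsupp.single g a = a • Finsupp.single g (1 : MvPolynomial I k) := by simp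
    rw [h, map_smul, map_smulₛₗ, Module.Relations.Solution.π_single, ιA_var, ← h, ← map_smul]
    congr 1
    simp [embX]

lemma toM_embY (f : P₂.G →₀ MvPolynomial J k) :
    toM P₁ P₂ (embY P₁ P₂ f) = ιB P₁ P₂ (P₂.π f) := by
  induction f using Finsupp.induction_linear with
  | zero => rw [map_zero, map_zero]; simp [embY]
  | add f g hf hg =>
    rw [map_add, map_add, ← hf, ← hg, ← map_add]
    congr 1
    simp only [embY]
    rw [Finsupp.mapRange_add (map_add _), Finsupp.mapDomain_add]
  | single g a =>
    have h : Finsupp.single g a = a • Finsupp.single g (1 : MvPolynomial J k) := by simp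
    rw [h, map_smul, map_smulₛₗ, Module.Relations.Solution.π_single, ιB_var, ← h, ← map_smul]
    congr 1
    simp [embY]

lemma lieElt_swap {L ι : Type*} [LieRing L] [LieAlgebra k L] (z : ι → L) (a b : L) :
    lieElt (k := k) z a b = - lieElt z b a :=
  Subtype.ext (lie_skew a b).symm

lemma lieElt_add_left {L ι : Type*} [LieRing L] [LieAlgebra k L] (z : ι → L) (a a' b : L) :
    lieElt (k := k) z (a + a') b = lieElt z a b + lieElt z a' b :=
  Subtype.ext (add_lie a a' b)

lemma lieElt_smul_left {L ι : Type*} [LieRing L] [LieAlgebra k L] [IsMetabelian L] (z : ι → L)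
    (c : k) (a b : L) :
    lieElt (k := k) z (c • a) b = (MvPolynomial.C c : MvPolynomial ι k) • lieElt z a b := by
  ext
  rw [CommutantModule.val_C_smul]
  exact smul_lie c a b

lemma lieElt_zero_left {L ι : Type*} [LieRing L] [LieAlgebra k L] (z : ι → L) (b : L) :
    lieElt (k := k) z 0 b = 0 :=
  Subtype.ext (zero_lie b)

lemma lieElt_self {L ι : Type*} [LieRing L] [LieAlgebra k L] (z : ι → L) (a : L) :
    lieElt (k := k) z a a = 0 :=
  Subtype.ext (lie_self a)

lemma toM_single (s : Gen I J P₁.G P₂.G) (a : MvPolynomial (I ⊕ J) k) :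
    toM P₁ P₂ (Finsupp.single s a) = a • toM P₁ P₂ (Finsupp.single s 1) := by
  rw [← map_smul]; simp

lemma wM_X_smul (i₁ i₂ : I) (j : J) :
    (MvPolynomial.X (Sum.inl i₂) : MvPolynomial (I ⊕ J) k) • wM P₁ P₂ i₁ j =
      (MvPolynomial.X (Sum.inl i₁) : MvPolynomial (I ⊕ J) k) • wM P₁ P₂ i₂ j +
        (MvPolynomial.X (Sum.inr j) : MvPolynomial (I ⊕ J) k) •
          ιA P₁ P₂ (lieElt x (x i₁) (x i₂)) := by
  have key : ∀ i₁ i₂ : I, i₂ < i₁ →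
    (MvPolynomial.X (Sum.inl i₂) : MvPolynomial (I ⊕ J) k) • wM P₁ P₂ i₁ j =
      (MvPolynomial.X (Sum.inl i₁) : MvPolynomial (I ⊕ J) k) • wM P₁ P₂ i₂ j +
        (MvPolynomial.X (Sum.inr j) : MvPolynomial (I ⊕ J) k) •
          ιA P₁ P₂ (lieElt x (x i₁) (x i₂)) := by
    intro i₁ i₂ h
    have := toM_relation P₁ P₂ (.sX i₁ i₂ j h)
    simp only [relM] at this
    rw [map_sub, map_add, map_smul, toM_embX, π_word, toM_single,
      toM_single P₁ P₂ (Gen.w i₂ j)] at this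
    exact sub_eq_zero.mp this
  rcases lt_trichotomy i₂ i₁ with h | rfl | h
  · exact key _ _ h
  · rw [lieElt_self, map_zero, smul_zero, add_zero]
  · rw [key _ _ h, lieElt_swap, map_neg, smul_neg]; abel

lemma wM_Y_smul (i : I) (j₁ j₂ : J) :
    (MvPolynomial.X (Sum.inr j₂) : MvPolynomial (I ⊕ J) k) • wM P₁ P₂ i j₁ =
      (MvPolynomial.X (Sum.inr j₁) : MvPolynomial (I ⊕ J) k) • wM P₁ P₂ i j₂ +
        (MvPolynomial.X (Sum.inl i) : MvPolynomial (I ⊕ J) k) •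
          ιB P₁ P₂ (lieElt y (y j₂) (y j₁)) := by
  have key : ∀ j₁ j₂ : J, j₂ < j₁ →
    (MvPolynomial.X (Sum.inr j₂) : MvPolynomial (I ⊕ J) k) • wM P₁ P₂ i j₁ =
      (MvPolynomial.X (Sum.inr j₁) : MvPolynomial (I ⊕ J) k) • wM P₁ P₂ i j₂ +
        (MvPolynomial.X (Sum.inl i) : MvPolynomial (I ⊕ J) k) •
          ιB P₁ P₂ (lieElt y (y j₂) (y j₁)) := by
    intro j₁ j₂ h
    have := toM_relation P₁ P₂ (.sY i j₁ j₂ h)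
    simp only [relM] at this
    rw [map_sub, map_add, map_smul, toM_embY, π_word, toM_single,
      toM_single P₁ P₂ (Gen.w i j₂)] at this
    exact sub_eq_zero.mp this
  rcases lt_trichotomy j₂ j₁ with h | rfl | h
  · exact key _ _ h
  · rw [lieElt_self, map_zero, smul_zero, add_zero]
  · rw [key _ _ h, lieElt_swap, map_neg, smul_neg]; abel

/-! ### The Lie algebra `C = V ⊕ M` -/

/-- The product of two basis elements of `V`, as an element of `M`. -/
def basisMul : I ⊕ J → I ⊕ J → ModM P₁ P₂
  | .inl i, .inl i' => ιA P₁ P₂ (lieElt x (x i) (x i'))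
  | .inr j, .inr j' => ιB P₁ P₂ (lieElt y (y j) (y j'))
  | .inl i, .inr j => wM P₁ P₂ i j
  | .inr j, .inl i => - wM P₁ P₂ i j

/-- The bilinear product `V × V → M`. -/
def mulV : (I ⊕ J →₀ k) →ₗ[k] (I ⊕ J →₀ k) →ₗ[k] ModM P₁ P₂ :=
  Finsupp.linearCombination k fun s => Finsupp.linearCombination k fun t => basisMul P₁ P₂ s t

/-- The vector space `C = V ⊕ M`, where `V` has the basis `X ∪ Y`. -/
def AlgC : Type _ := (I ⊕ J →₀ k) × ModM P₁ P₂

instance : AddCommGroup (AlgC P₁ P₂) :=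
  inferInstanceAs (AddCommGroup ((I ⊕ J →₀ k) × ModM P₁ P₂))

instance : Module k (AlgC P₁ P₂) :=
  inferInstanceAs (Module k ((I ⊕ J →₀ k) × ModM P₁ P₂))

variable {P₁ P₂} in
/-- The element `(v, m)` of `C`. -/
def AlgC.mk (v : I ⊕ J →₀ k) (m : ModM P₁ P₂) : AlgC P₁ P₂ := (v, m)

variable {P₁ P₂} in
/-- The component of an element of `C` in `V`. -/
def AlgC.v (c : AlgC P₁ P₂) : I ⊕ J →₀ k := Prod.fst c

variable {P₁ P₂} in
/-- The component of an element of `C` in `M`. -/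
def AlgC.m (c : AlgC P₁ P₂) : ModM P₁ P₂ := Prod.snd c

/-- `(v₁, m₁) ∘ (v₂, m₂) = (0, v₁ v₂ - m₂ · v₁ + m₁ · v₂)` -/
instance : Bracket (AlgC P₁ P₂) (AlgC P₁ P₂) where
  bracket c d :=
    AlgC.mk 0 (mulV P₁ P₂ c.v d.v - linForm k I J c.v • d.m + linForm k I J d.v • c.m)

lemma mulV_single (s t : I ⊕ J) (a b : k) :
    mulV P₁ P₂ (Finsupp.single s a) (Finsupp.single t b) = a • b • basisMul P₁ P₂ s t := by
  simp [mulV]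

lemma basisMul_swap (s t : I ⊕ J) : basisMul P₁ P₂ s t = - basisMul P₁ P₂ t s := by
  rcases s with i | j <;> rcases t with i' | j' <;> simp only [basisMul, neg_neg]
  · rw [lieElt_swap, map_neg]
  · rw [lieElt_swap, map_neg]

lemma basisMul_self (s : I ⊕ J) : basisMul P₁ P₂ s s = 0 := by
  rcases s with i | j <;> simp only [basisMul, lieElt_self, map_zero]

lemma mulV_swap (u v : I ⊕ J →₀ k) : mulV P₁ P₂ u v = - mulV P₁ P₂ v u := by
  induction u using Finsupp.induction_linear with
  | zero => simp
  | add u u' h h' => simp only [map_add, LinearMap.add_apply, h, h', neg_add]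
  | single s a =>
    induction v using Finsupp.induction_linear with
    | zero => simp
    | add u u' h h' => simp only [map_add, LinearMap.add_apply, h, h', neg_add]
    | single t b =>
      rw [mulV_single, mulV_single, basisMul_swap, smul_neg, smul_neg, smul_comm]

lemma mulV_self (v : I ⊕ J →₀ k) : mulV P₁ P₂ v v = 0 := by
  induction v using Finsupp.induction_linear with
  | zero => simp
  | add u u' h h' =>
    simp only [map_add, LinearMap.add_apply, h, h', mulV_swap P₁ P₂ u' u]
    abel
  | single t b => rw [mulV_single, basisMul_self, smul_zero, smul_zero]

lemma jacobi_lieElt {L ι : Type*} [LieRing L] [LieAlgebra k L] [IsMetabelian L] (z : ι → L)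
    (a b c : ι) :
    (MvPolynomial.X c : MvPolynomial ι k) • lieElt (k := k) z (z a) (z b) +
      (MvPolynomial.X a : MvPolynomial ι k) • lieElt (k := k) z (z b) (z c) +
      (MvPolynomial.X b : MvPolynomial ι k) • lieElt (k := k) z (z c) (z a) = 0 := by
  ext
  rw [CommutantModule.val_add, CommutantModule.val_add, CommutantModule.val_X_smul,
    CommutantModule.val_X_smul, CommutantModule.val_X_smul]
  change ⁅⁅z a, z b⁆, z c⁆ + ⁅⁅z b, z c⁆, z a⁆ + ⁅⁅z c, z a⁆, z b⁆ = 0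
  have h := lie_jacobi (z a) (z b) (z c)
  rw [← lie_skew (z a), ← lie_skew (z b) ⁅_, _⁆, ← lie_skew (z c) ⁅_, _⁆] at h
  rw [← neg_eq_zero, ← h]; abel

lemma basisMul_jacobi (r s t : I ⊕ J) :
    (MvPolynomial.X t : MvPolynomial (I ⊕ J) k) • basisMul P₁ P₂ r s +
      (MvPolynomial.X r : MvPolynomial (I ⊕ J) k) • basisMul P₁ P₂ s t +
      (MvPolynomial.X s : MvPolynomial (I ⊕ J) k) • basisMul P₁ P₂ t r = 0 := by
  have hx : ∀ (a b : I) (c : J),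
      (MvPolynomial.X (Sum.inr c) : MvPolynomial (I ⊕ J) k) •
          ιA P₁ P₂ (lieElt x (x a) (x b)) +
        (MvPolynomial.X (Sum.inl a) : MvPolynomial (I ⊕ J) k) • wM P₁ P₂ b c -
        (MvPolynomial.X (Sum.inl b) : MvPolynomial (I ⊕ J) k) • wM P₁ P₂ a c = 0 := by
    intro a b c
    rw [wM_X_smul P₁ P₂ a b c]; abel
  have hy : ∀ (a : I) (b c : J),
      (MvPolynomial.X (Sum.inl a) : MvPolynomial (I ⊕ J) k) •
          ιB P₁ P₂ (lieElt y (y b) (y c)) +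
        (MvPolynomial.X (Sum.inr c) : MvPolynomial (I ⊕ J) k) • wM P₁ P₂ a b -
        (MvPolynomial.X (Sum.inr b) : MvPolynomial (I ⊕ J) k) • wM P₁ P₂ a c = 0 := by
    intro a b c
    rw [wM_Y_smul P₁ P₂ a c b]; abel
  rcases r with a | a <;> rcases s with b | b <;> rcases t with c | c <;>
    simp only [basisMul, smul_neg]
  · rw [← ιA_X_smul, ← ιA_X_smul, ← ιA_X_smul, ← map_add, ← map_add, jacobi_lieElt, map_zero]
  · rw [← hx a b c]; abel
  · rw [← hx c a b]; abel
  · rw [← hy a b c]; abel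
  · rw [← hx b c a]; abel
  · rw [← hy b c a]; abel
  · rw [← hy c a b]; abel
  · rw [← ιB_X_smul, ← ιB_X_smul, ← ιB_X_smul, ← map_add, ← map_add, jacobi_lieElt, map_zero]

lemma mulV_jacobi (u v w : I ⊕ J →₀ k) :
    linForm k I J w • mulV P₁ P₂ u v + linForm k I J u • mulV P₁ P₂ v w +
      linForm k I J v • mulV P₁ P₂ w u = 0 := by
  induction u using Finsupp.induction_linear with
  | zero => simp
  | add u u' h h' =>
    rw [← add_zero (0 : ModM P₁ P₂)]
    nth_rewrite 1 [← h]
    rw [← h']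
    simp only [map_add, LinearMap.add_apply, add_smul, smul_add]
    abel
  | single r a =>
    induction v using Finsupp.induction_linear with
    | zero => simp
    | add u u' h h' =>
      rw [← add_zero (0 : ModM P₁ P₂)]
      nth_rewrite 1 [← h]
      rw [← h']
      simp only [map_add, LinearMap.add_apply, add_smul, smul_add]
      abel
    | single s b =>
      induction w using Finsupp.induction_linear with
      | zero => simp
      | add u u' h h' =>
        rw [← add_zero (0 : ModM P₁ P₂)]
        nth_rewrite 1 [← h]
        rw [← h']
        simp only [map_add, LinearMap.add_apply, add_smul, smul_add]
        abel
      | single t c =>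
        simp only [mulV_single, linForm_single]
        simp only [← C_smul, MvPolynomial.smul_eq_C_mul]
        linear_combination (norm := module)
          (MvPolynomial.C a * MvPolynomial.C b * MvPolynomial.C c : MvPolynomial (I ⊕ J) k) •
            basisMul_jacobi P₁ P₂ r s t

namespace AlgC

variable {P₁ P₂}

@[ext] lemma ext {c d : AlgC P₁ P₂} (h₁ : c.v = d.v) (h₂ : c.m = d.m) : c = d :=
  Prod.ext h₁ h₂

lemma v_mk (v : I ⊕ J →₀ k) (m : ModM P₁ P₂) : (mk v m).v = v := rfl
lemma m_mk (v : I ⊕ J →₀ k) (m : ModM P₁ P₂) : (mk v m).m = m := rfl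
lemma v_add (c d : AlgC P₁ P₂) : (c + d).v = c.v + d.v := rfl
lemma m_add (c d : AlgC P₁ P₂) : (c + d).m = c.m + d.m := rfl
lemma v_smul (a : k) (c : AlgC P₁ P₂) : (a • c).v = a • c.v := rfl
lemma m_smul (a : k) (c : AlgC P₁ P₂) : (a • c).m = a • c.m := rfl
lemma v_lie (c d : AlgC P₁ P₂) : ⁅c, d⁆.v = 0 := rfl
lemma m_lie (c d : AlgC P₁ P₂) : ⁅c, d⁆.m =
    mulV P₁ P₂ c.v d.v - linForm k I J c.v • d.m + linForm k I J d.v • c.m := rfl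

instance : LieRing (AlgC P₁ P₂) where
  add_lie c d e := by
    ext1
    · simp only [v_add, v_lie, add_zero]
    · simp only [v_add, m_add, m_lie, map_add, LinearMap.add_apply, add_smul, smul_add]
      abel
  lie_add c d e := by
    ext1
    · simp only [v_add, v_lie, add_zero]
    · simp only [v_add, m_add, m_lie, map_add, add_smul, smul_add]
      abel
  lie_self c := by
    ext1
    · rfl
    · rw [m_lie, mulV_self, zero_sub, neg_add_cancel]; rfl
  leibniz_lie c d e := by
    ext1
    · simp only [v_add, v_lie, add_zero]
    · have h := mulV_jacobi P₁ P₂ c.v d.v e.v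
      rw [mulV_swap P₁ P₂ e.v c.v, smul_neg] at h
      simp only [m_add, m_lie, v_lie, map_zero, LinearMap.zero_apply, zero_smul, smul_add,
        smul_sub, zero_sub, add_zero]
      linear_combination (norm := module) (-1 : MvPolynomial (I ⊕ J) k) • h

instance : LieAlgebra k (AlgC P₁ P₂) where
  lie_smul a c d := by
    ext1
    · simp only [v_smul, v_lie, smul_zero]
    · simp only [v_smul, m_smul, m_lie, map_smul, smul_add, smul_sub]
      simp only [← C_smul, MvPolynomial.smul_eq_C_mul, smul_smul]
      rw [mul_comm (linForm k I J c.v)]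

instance : IsMetabelian (AlgC P₁ P₂) where
  lie_lie_lie_lie a b c d := by
    ext1
    · rfl
    · rw [m_lie, v_lie, v_lie]
      simp only [map_zero, zero_smul, sub_zero, add_zero]
      rfl

end AlgC

end ModuleM

/-! ### The natural homomorphism `A ∗ B → C` -/

section Psi

variable {k A B I J : Type*} [Field k]
  [LieRing A] [LieAlgebra k A] [IsMetabelian A] [LieRing B] [LieAlgebra k B] [IsMetabelian B]
  [LinearOrder I] [LinearOrder J]

namespace LiftedBasis

variable {ι L : Type*} [LieRing L] [LieAlgebra k L] (X : LiftedBasis ι k L)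

/-- The coordinates of `a` modulo `L²`. -/
def coord : L →ₗ[k] (ι →₀ k) :=
  X.basis.repr.toLinearMap ∘ₗ (LieSubmodule.toSubmodule (commutant k L)).mkQ

/-- The linear combination of the fixed preimages with given coefficients. -/
def comb : (ι →₀ k) →ₗ[k] L := Finsupp.linearCombination k X.elt

lemma coord_comb (v : ι →₀ k) : X.coord (X.comb v) = v := by
  induction v using Finsupp.induction_linear with
  | zero => simp
  | add u v hu hv => rw [map_add, map_add, hu, hv]
  | single i a =>
    have h : X.coord (X.elt i) = Finsupp.single i 1 := by
      have := congrArg X.basis.repr (X.mk_elt i)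
      rwa [X.basis.repr_self] at this
    simp [comb, h]

lemma coord_eq_zero {a : L} (h : a ∈ commutant k L) : X.coord a = 0 := by
  have : (LieSubmodule.toSubmodule (commutant k L)).mkQ a = 0 :=
    (Submodule.Quotient.mk_eq_zero _).mpr h
  simp [coord, this]

lemma sub_mem (a : L) : a - X.comb (X.coord a) ∈ commutant k L := by
  have h : X.coord (a - X.comb (X.coord a)) = 0 := by rw [map_sub, coord_comb, sub_self]
  have h' : (LieSubmodule.toSubmodule (commutant k L)).mkQ (a - X.comb (X.coord a)) = 0 :=
    X.basis.repr.map_eq_zero_iff.mp h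
  exact (Submodule.Quotient.mk_eq_zero _).mp h'

/-- The component of `a` in `L²`, with respect to the decomposition of `L` as the direct sum of
`L²` and the span of the fixed preimages. -/
def rest (a : L) : CommutantModule k X.elt := CommutantModule.mk _ _ (X.sub_mem a)

lemma val_rest (a : L) : (X.rest a).val = a - X.comb (X.coord a) := rfl

end LiftedBasis

variable {X : LiftedBasis I k A} {Y : LiftedBasis J k B}
  (P₁ : Module.Presentation (MvPolynomial I k) (CommutantModule k X.elt))
  (P₂ : Module.Presentation (MvPolynomial J k) (CommutantModule k Y.elt))

lemma mulV_X (u v : I →₀ k) :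
    mulV P₁ P₂ (u.mapDomain Sum.inl) (v.mapDomain Sum.inl) =
      ιA P₁ P₂ (lieElt X.elt (X.comb u) (X.comb v)) := by
  induction u using Finsupp.induction_linear with
  | zero =>
    rw [Finsupp.mapDomain_zero, map_zero, map_zero, lieElt_zero_left, map_zero]; rfl
  | add u u' h h' =>
    rw [Finsupp.mapDomain_add, map_add, LinearMap.add_apply, h, h', map_add, lieElt_add_left,
      map_add]
  | single i a =>
    rw [lieElt_swap, map_neg, mulV_swap]
    congr 1
    induction v using Finsupp.induction_linear with
    | zero =>
      rw [Finsupp.mapDomain_zero, map_zero, map_zero, lieElt_zero_left, map_zero]; rfl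
    | add u u' h h' =>
      rw [Finsupp.mapDomain_add, map_add, LinearMap.add_apply, h, h', map_add, lieElt_add_left,
        map_add]
    | single i' b =>
      rw [Finsupp.mapDomain_single, Finsupp.mapDomain_single, mulV_single]
      simp only [LiftedBasis.comb, Finsupp.linearCombination_single]
      rw [lieElt_smul_left, lieElt_swap, lieElt_smul_left, ιA_C_smul, map_neg, ιA_C_smul,
        ← smul_neg, ← map_neg, ← lieElt_swap]
      rfl

lemma linForm_smul_ιA (v : I →₀ k) (d : CommutantModule k X.elt) :
    linForm k I J (v.mapDomain Sum.inl) • ιA P₁ P₂ d =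
      ιA P₁ P₂ (lieElt X.elt d.val (X.comb v)) := by
  induction v using Finsupp.induction_linear with
  | zero =>
    rw [Finsupp.mapDomain_zero, map_zero, map_zero, lieElt_swap, lieElt_zero_left, neg_zero,
      map_zero, zero_smul]
  | add u u' h h' =>
    rw [Finsupp.mapDomain_add, map_add, add_smul, h, h', map_add,
      lieElt_swap X.elt d.val (X.comb u + X.comb u'), lieElt_add_left,
      neg_add, ← lieElt_swap, ← lieElt_swap, map_add]
  | single i a =>
    have h : lieElt (k := k) X.elt d.val (X.comb (Finsupp.single i a)) =
        (MvPolynomial.C a : MvPolynomial I k) • (MvPolynomial.X i : MvPolynomial I k) • d := by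
      ext
      rw [CommutantModule.val_C_smul, CommutantModule.val_X_smul]
      simp only [LiftedBasis.comb, Finsupp.linearCombination_single]
      exact lie_smul a _ _
    rw [h, ιA_C_smul, ιA_X_smul, Finsupp.mapDomain_single, linForm_single, smul_assoc]

/-- The natural homomorphism `A → C`. It sends the fixed preimages of the basis elements to the
corresponding basis elements of `V`, and an element of `A²` to its image in `M`. -/
def toCA : A →ₗ⁅k⁆ AlgC P₁ P₂ where
  toFun a := AlgC.mk ((X.coord a).mapDomain Sum.inl) (ιA P₁ P₂ (X.rest a))
  map_add' a b := by
    have h : X.rest (a + b) = X.rest a + X.rest b := by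
      ext
      rw [CommutantModule.val_add]
      simp only [LiftedBasis.val_rest, map_add]
      abel
    ext1
    · rw [AlgC.v_add, AlgC.v_mk, AlgC.v_mk, AlgC.v_mk, map_add, Finsupp.mapDomain_add]
    · rw [AlgC.m_add, AlgC.m_mk, AlgC.m_mk, AlgC.m_mk, h, map_add]
  map_smul' c a := by
    have h : X.rest (c • a) = (MvPolynomial.C c : MvPolynomial I k) • X.rest a := by
      ext
      rw [CommutantModule.val_C_smul]
      simp only [LiftedBasis.val_rest, map_smul, smul_sub]
    ext1
    · rw [RingHom.id_apply, AlgC.v_smul, AlgC.v_mk, AlgC.v_mk, map_smul, Finsupp.mapDomain_smul]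
    · rw [RingHom.id_apply, AlgC.m_smul, AlgC.m_mk, AlgC.m_mk, h, ιA_C_smul]
  map_lie' {a b} := by
    ext1
    · rw [AlgC.v_lie, AlgC.v_mk, X.coord_eq_zero (lie_mem_commutant a b), Finsupp.mapDomain_zero]
    · rw [AlgC.m_lie]
      simp only [AlgC.v_mk, AlgC.m_mk]
      rw [mulV_X, linForm_smul_ιA, linForm_smul_ιA, ← map_sub, ← map_add]
      congr 1
      ext
      have h := lie_eq_zero_of_mem_commutant (X.sub_mem a) (X.sub_mem b)
      rw [X.val_rest, X.coord_eq_zero (lie_mem_commutant a b), map_zero, sub_zero]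
      change ⁅a, b⁆ = ⁅X.comb (X.coord a), X.comb (X.coord b)⁆ -
        ⁅b - X.comb (X.coord b), X.comb (X.coord a)⁆ +
          ⁅a - X.comb (X.coord a), X.comb (X.coord b)⁆
      rw [← lie_skew (b - _)]
      simp only [sub_lie, lie_sub] at h ⊢
      rw [← sub_eq_zero, ← h]
      abel

lemma mulV_Y (u v : J →₀ k) :
    mulV P₁ P₂ (u.mapDomain Sum.inr) (v.mapDomain Sum.inr) =
      ιB P₁ P₂ (lieElt Y.elt (Y.comb u) (Y.comb v)) := by
  induction u using Finsupp.induction_linear with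
  | zero =>
    rw [Finsupp.mapDomain_zero, map_zero, map_zero, lieElt_zero_left, map_zero]; rfl
  | add u u' h h' =>
    rw [Finsupp.mapDomain_add, map_add, LinearMap.add_apply, h, h', map_add, lieElt_add_left,
      map_add]
  | single i a =>
    rw [lieElt_swap, map_neg, mulV_swap]
    congr 1
    induction v using Finsupp.induction_linear with
    | zero =>
      rw [Finsupp.mapDomain_zero, map_zero, map_zero, lieElt_zero_left, map_zero]; rfl
    | add u u' h h' =>
      rw [Finsupp.mapDomain_add, map_add, LinearMap.add_apply, h, h', map_add, lieElt_add_left,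
        map_add]
    | single i' b =>
      rw [Finsupp.mapDomain_single, Finsupp.mapDomain_single, mulV_single]
      simp only [LiftedBasis.comb, Finsupp.linearCombination_single]
      rw [lieElt_smul_left, lieElt_swap, lieElt_smul_left, ιB_C_smul, map_neg, ιB_C_smul,
        ← smul_neg, ← map_neg, ← lieElt_swap]
      rfl

lemma linForm_smul_ιB (v : J →₀ k) (d : CommutantModule k Y.elt) :
    linForm k I J (v.mapDomain Sum.inr) • ιB P₁ P₂ d =
      ιB P₁ P₂ (lieElt Y.elt d.val (Y.comb v)) := by
  induction v using Finsupp.induction_linear with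
  | zero =>
    rw [Finsupp.mapDomain_zero, map_zero, map_zero, lieElt_swap, lieElt_zero_left, neg_zero,
      map_zero, zero_smul]
  | add u u' h h' =>
    rw [Finsupp.mapDomain_add, map_add, add_smul, h, h', map_add,
      lieElt_swap Y.elt d.val (Y.comb u + Y.comb u'), lieElt_add_left,
      neg_add, ← lieElt_swap, ← lieElt_swap, map_add]
  | single i a =>
    have h : lieElt (k := k) Y.elt d.val (Y.comb (Finsupp.single i a)) =
        (MvPolynomial.C a : MvPolynomial J k) • (MvPolynomial.X i : MvPolynomial J k) • d := by
      ext
      rw [CommutantModule.val_C_smul, CommutantModule.val_X_smul]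
      simp only [LiftedBasis.comb, Finsupp.linearCombination_single]
      exact lie_smul a _ _
    rw [h, ιB_C_smul, ιB_X_smul, Finsupp.mapDomain_single, linForm_single, smul_assoc]

/-- The natural homomorphism `B → C`. It sends the fixed preimages of the basis elements to the
corresponding basis elements of `V`, and an element of `B²` to its image in `M`. -/
def toCB : B →ₗ⁅k⁆ AlgC P₁ P₂ where
  toFun a := AlgC.mk ((Y.coord a).mapDomain Sum.inr) (ιB P₁ P₂ (Y.rest a))
  map_add' a b := by
    have h : Y.rest (a + b) = Y.rest a + Y.rest b := by
      ext
      rw [CommutantModule.val_add]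
      simp only [LiftedBasis.val_rest, map_add]
      abel
    ext1
    · rw [AlgC.v_add, AlgC.v_mk, AlgC.v_mk, AlgC.v_mk, map_add, Finsupp.mapDomain_add]
    · rw [AlgC.m_add, AlgC.m_mk, AlgC.m_mk, AlgC.m_mk, h, map_add]
  map_smul' c a := by
    have h : Y.rest (c • a) = (MvPolynomial.C c : MvPolynomial J k) • Y.rest a := by
      ext
      rw [CommutantModule.val_C_smul]
      simp only [LiftedBasis.val_rest, map_smul, smul_sub]
    ext1
    · rw [RingHom.id_apply, AlgC.v_smul, AlgC.v_mk, AlgC.v_mk, map_smul, Finsupp.mapDomain_smul]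
    · rw [RingHom.id_apply, AlgC.m_smul, AlgC.m_mk, AlgC.m_mk, h, ιB_C_smul]
  map_lie' {a b} := by
    ext1
    · rw [AlgC.v_lie, AlgC.v_mk, Y.coord_eq_zero (lie_mem_commutant a b), Finsupp.mapDomain_zero]
    · rw [AlgC.m_lie]
      simp only [AlgC.v_mk, AlgC.m_mk]
      rw [mulV_Y, linForm_smul_ιB, linForm_smul_ιB, ← map_sub, ← map_add]
      congr 1
      ext
      have h := lie_eq_zero_of_mem_commutant (Y.sub_mem a) (Y.sub_mem b)
      rw [Y.val_rest, Y.coord_eq_zero (lie_mem_commutant a b), map_zero, sub_zero]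
      change ⁅a, b⁆ = ⁅Y.comb (Y.coord a), Y.comb (Y.coord b)⁆ -
        ⁅b - Y.comb (Y.coord b), Y.comb (Y.coord a)⁆ +
          ⁅a - Y.comb (Y.coord a), Y.comb (Y.coord b)⁆
      rw [← lie_skew (b - _)]
      simp only [sub_lie, lie_sub] at h ⊢
      rw [← sub_eq_zero, ← h]
      abel

/-- The natural homomorphism `ψ : A ∗ B → C`. -/
def psi : MetabelianProduct k A B →ₗ⁅k⁆ AlgC P₁ P₂ :=
  MetabelianProduct.lift (toCA P₁ P₂) (toCB P₁ P₂)

variable (X Y) in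
/-- The family `X ∪ Y` of elements of `A ∗ B`. -/
def genXY : I ⊕ J → MetabelianProduct k A B :=
  Sum.elim (fun i => MetabelianProduct.inA k A B (X.elt i))
    (fun j => MetabelianProduct.inB k A B (Y.elt j))

variable (X Y) in
/-- The `k[X ∪ Y]`-submodule of `(A ∗ B)²` generated by `A²`. -/
def genByA : Submodule (MvPolynomial (I ⊕ J) k) (CommutantModule k (genXY X Y)) :=
  Submodule.span _ {d | ∃ a ∈ commutant k A, d.val = MetabelianProduct.inA k A B a}

variable (X Y) in
/-- The `k[X ∪ Y]`-submodule of `(A ∗ B)²` generated by `B²`. -/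
def genByB : Submodule (MvPolynomial (I ⊕ J) k) (CommutantModule k (genXY X Y)) :=
  Submodule.span _ {d | ∃ b ∈ commutant k B, d.val = MetabelianProduct.inB k A B b}

/-- The module `M₁ = A² ⊗_{k[X]} k[X ∪ Y]`. -/
abbrev M₁ (X : LiftedBasis I k A) (J : Type*) : Type _ := ExtendScalars (inclX k I J) (CommutantModule k X.elt)

/-- The module `M₂ = B² ⊗_{k[Y]} k[X ∪ Y]`. -/
abbrev M₂ (I : Type*) (Y : LiftedBasis J k B) : Type _ := ExtendScalars (inclY k I J) (CommutantModule k Y.elt)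

/-- The ideal `U(C) = {(0, m) | m ∈ M}` of `C`. -/
def UC : LieIdeal k (AlgC P₁ P₂) where
  carrier := {c | c.v = 0}
  add_mem' {c d} hc hd := by
    change c.v + d.v = 0
    rw [show c.v = 0 from hc, show d.v = 0 from hd, add_zero]
  zero_mem' := rfl
  smul_mem' a c hc := by
    change a • c.v = 0
    rw [show c.v = 0 from hc, smul_zero]
  lie_mem := fun _ => rfl

end Psi

end MetabelianLie

end

open MetabelianLie

/-! The inverse of `psi` is written down explicitly. By the Jacobi identity the brackets of `x_i`
with `y_j` in `(A ∗ B)²` satisfy the defining relations of `M`, so the universal property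
`ModM.lift` yields an `R`-linear map `toComm` from `M` to `(A ∗ B)²`. Joined with the obvious map on
`V` it gives `psiInv`. One composite is tested on `A` and `B`, the other on the basis of `V` and on
module generators of `M`. Brackets in `C` have no component in `V`, hence `toComm` is bijective, and
what remains is a question about the module `M` alone.

To see that `M₁` embeds in `M` and meets the image of `M₂` trivially, one needs a map out of `M`
that is injective on `M₁` and kills `B²`. It sends `w_ij` to `y_j e_i`, where the `e_i` live in an
extension of the ideal `(x_i)` by `M₁` with `x_b e_a - x_a e_b` equal to the product of `x_a` and
`x_b` (`SyzygyExt`). The syzygies of variables are of Koszul type, and the only possible obstruction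
to `M₁` surviving in this extension is removed by the Jacobi identity in `A`: this is
`SyzygyExt.inl_injective`, which rests on an additive map given by a formula on monomials
(`exists_syzygy_section`). Exchanging the roles of `A` and `B` treats `M₂`.

For the quotient, sending `w_ij` to `x_i y_j` maps `M` onto `M₀`. Its kernel is no larger than the
sum of the two submodules because any two ways of splitting a factor `x_i y_j` off a monomial are
linked by exchanging one variable at a time (`exists_addMonoidHom_mul_X_mul_X`). -/

noncomputable section

namespace MetabelianLie

set_option linter.unusedSectionVars false

/-! ### Extension of scalars as a universal target of semilinear maps. -/

namespace ExtendScalars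

variable {R S : Type*} [CommRing R] [CommRing S] (f : R →+* S) (N : Type*)
    [AddCommGroup N] [Module R N]

/-- The canonical semilinear map from a module to its extension of scalars. -/
def ofₛₗ : N →ₛₗ[f] ExtendScalars f N :=
  letI := f.toAlgebra
  { toFun := of f
    map_add' := fun m n => TensorProduct.tmul_add (1 : S) m n
    map_smul' := fun r n => by
      change (1 : S) ⊗ₜ[R] (r • n) = f r • ((1 : S) ⊗ₜ[R] n)
      rw [TensorProduct.tmul_smul, TensorProduct.smul_tmul', TensorProduct.smul_tmul',
        Algebra.smul_def, smul_eq_mul]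
      rfl }

/-- This is what allows linear maps out of the extension to be compared on the elements `1 ⊗ n`
only. -/
lemma span_range_of : Submodule.span S (Set.range (of f : N → ExtendScalars f N)) = ⊤ := by
  let _ := f.toAlgebra
  rw [eq_top_iff]
  rintro t -
  change S ⊗[R] N at t
  induction t using TensorProduct.induction_on with
  | zero => exact Submodule.zero_mem _
  | tmul s n =>
    have h : s ⊗ₜ[R] n = s • ((1 : S) ⊗ₜ[R] n) := by
      rw [TensorProduct.smul_tmul', smul_eq_mul, mul_one]
    rw [h]
    exact Submodule.smul_mem _ _ (Submodule.subset_span ⟨n, rfl⟩)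
  | add a b ha hb => exact Submodule.add_mem _ ha hb

variable {N} {f}
variable {Q : Type*} [AddCommGroup Q] [Module S Q]

/-- The linear map induced by a semilinear map. -/
def lift (g : N →ₛₗ[f] Q) : ExtendScalars f N →ₗ[S] Q :=
  letI := f.toAlgebra
  -- Restricting scalars along `f` turns the semilinear `g` into an `R`-linear map, to which the
  -- adjunction for base change applies.
  letI : Module R Q := Module.compHom Q f
  haveI : IsScalarTower R S Q := ⟨fun r s q => by
    rw [Algebra.smul_def, mul_smul]; rfl⟩
  LinearMap.liftBaseChange S
    ({ toFun := g, map_add' := map_add g, map_smul' := fun r n => map_smulₛₗ g r n } : N →ₗ[R] Q)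

lemma lift_of (g : N →ₛₗ[f] Q) (n : N) : lift g (of f n) = g n := by
  let _ := f.toAlgebra
  let _ : Module R Q := Module.compHom Q f
  have : IsScalarTower R S Q := ⟨fun r s q => by
    rw [Algebra.smul_def, mul_smul]; rfl⟩
  exact (LinearMap.liftBaseChange_tmul S _ _ _).trans (one_smul S _)

/-- Used to recognise the images of `M₁` and `M₂` as the submodules generated by `A²` and `B²`. -/
lemma range_lift (g : N →ₛₗ[f] Q) :
    LinearMap.range (lift g) = Submodule.span S (Set.range g) := by
  rw [LinearMap.range_eq_map, ← span_range_of, Submodule.map_span, ← Set.range_comp]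
  congr 2
  ext n
  exact lift_of g n

lemma hom_ext {g h : ExtendScalars f N →ₗ[S] Q} (H : ∀ n, g (of f n) = h (of f n)) : g = h :=
  LinearMap.ext_on (span_range_of f N) (by rintro _ ⟨n, rfl⟩; exact H n)

end ExtendScalars

/-! ### The universal property of `M`. -/

section ModuleM

variable {k A B I J : Type*} [Field k]
  [LieRing A] [LieAlgebra k A] [IsMetabelian A] [LieRing B] [LieAlgebra k B] [IsMetabelian B]
variable {x : I → A} {y : J → B}
  (P₁ : Module.Presentation (MvPolynomial I k) (CommutantModule k x))
  (P₂ : Module.Presentation (MvPolynomial J k) (CommutantModule k y))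
variable {Q : Type*} [AddCommGroup Q] [Module (MvPolynomial (I ⊕ J) k) Q]

namespace ModM

/-- The map on words in the generators of `M` determined by maps on `A²`, `B²` and the values at
the generators `w_ij`. -/
def wordMap (gA : CommutantModule k x →ₛₗ[inclX k I J] Q)
    (gB : CommutantModule k y →ₛₗ[inclY k I J] Q) (W : I → J → Q) :
    (Gen I J P₁.G P₂.G →₀ MvPolynomial (I ⊕ J) k) →ₗ[MvPolynomial (I ⊕ J) k] Q :=
  Finsupp.linearCombination _ fun
    | .w i j => W i j
    | .z₁ g => gA (P₁.var g)
    | .z₂ g => gB (P₂.var g)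

section

variable (gA : CommutantModule k x →ₛₗ[inclX k I J] Q)
  (gB : CommutantModule k y →ₛₗ[inclY k I J] Q) (W : I → J → Q)

/-- The value depends only on the element of `A²` that the word represents. Hence the relations of
`P₁` go to zero, and the arbitrary choice made by `word` in the relations of `M` is harmless. -/
lemma wordMap_embX (f : P₁.G →₀ MvPolynomial I k) :
    wordMap P₁ P₂ gA gB W (embX P₁ P₂ f) = gA (P₁.π f) := by
  induction f using Finsupp.induction_linear with
  | zero => rw [map_zero, map_zero]; simp [embX]
  | add f g hf hg =>
    rw [map_add, map_add, ← hf, ← hg, ← map_add]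
    congr 1
    simp only [embX]
    rw [Finsupp.mapRange_add (map_add _), Finsupp.mapDomain_add]
  | single g a =>
    have h : Finsupp.single g a = a • Finsupp.single g (1 : MvPolynomial I k) := by simp
    rw [h, map_smul, map_smulₛₗ, Module.Relations.Solution.π_single, ← h]
    simp [embX, wordMap]

lemma wordMap_embY (f : P₂.G →₀ MvPolynomial J k) :
    wordMap P₁ P₂ gA gB W (embY P₁ P₂ f) = gB (P₂.π f) := by
  induction f using Finsupp.induction_linear with
  | zero => rw [map_zero, map_zero]; simp [embY]
  | add f g hf hg =>
    rw [map_add, map_add, ← hf, ← hg, ← map_add]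
    congr 1
    simp only [embY]
    rw [Finsupp.mapRange_add (map_add _), Finsupp.mapDomain_add]
  | single g a =>
    have h : Finsupp.single g a = a • Finsupp.single g (1 : MvPolynomial J k) := by simp
    rw [h, map_smul, map_smulₛₗ, Module.Relations.Solution.π_single, ← h]
    simp [embY, wordMap]

-- The identities are required for all pairs of indices, whereas `M` imposes them only for ordered
-- pairs. Nothing is lost: `lieElt` is alternating, so the remaining cases follow.
variable [LinearOrder I] [LinearOrder J]
  (hY : ∀ i j₁ j₂, (MvPolynomial.X (Sum.inr j₂) : MvPolynomial (I ⊕ J) k) • W i j₁ =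
    (MvPolynomial.X (Sum.inr j₁) : MvPolynomial (I ⊕ J) k) • W i j₂ +
      (MvPolynomial.X (Sum.inl i) : MvPolynomial (I ⊕ J) k) • gB (lieElt y (y j₂) (y j₁)))
  (hX : ∀ i₁ i₂ j, (MvPolynomial.X (Sum.inl i₂) : MvPolynomial (I ⊕ J) k) • W i₁ j =
    (MvPolynomial.X (Sum.inl i₁) : MvPolynomial (I ⊕ J) k) • W i₂ j +
      (MvPolynomial.X (Sum.inr j) : MvPolynomial (I ⊕ J) k) • gA (lieElt x (x i₁) (x i₂)))

/-- The universal property of `M`, in terms of the natural maps from `A²` and `B²`. -/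
def lift : ModM P₁ P₂ →ₗ[MvPolynomial (I ⊕ J) k] Q :=
  Module.Relations.Solution.fromQuotient (relations := relM P₁ P₂) <|
    .ofπ (wordMap P₁ P₂ gA gB W) fun
      | .r₁ r => (wordMap_embX P₁ P₂ gA gB W _).trans (by
          rw [Module.Relations.Solution.π_relation, map_zero])
      | .r₂ r => (wordMap_embY P₁ P₂ gA gB W _).trans (by
          rw [Module.Relations.Solution.π_relation, map_zero])
      | .sY i j₁ j₂ _ => by
          change wordMap P₁ P₂ gA gB W (Finsupp.single (Gen.w i j₁) (MvPolynomial.X (Sum.inr j₂)) -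
            (Finsupp.single (Gen.w i j₂) (MvPolynomial.X (Sum.inr j₁)) +
              (MvPolynomial.X (Sum.inl i) : MvPolynomial (I ⊕ J) k) •
                embY P₁ P₂ (word P₂ (lieElt y (y j₂) (y j₁))))) = 0
          rw [map_sub, map_add, map_smul, wordMap_embY, π_word, sub_eq_zero]
          simpa [wordMap] using hY i j₁ j₂
      | .sX i₁ i₂ j _ => by
          change wordMap P₁ P₂ gA gB W (Finsupp.single (Gen.w i₁ j) (MvPolynomial.X (Sum.inl i₂)) -
            (Finsupp.single (Gen.w i₂ j) (MvPolynomial.X (Sum.inl i₁)) +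
              (MvPolynomial.X (Sum.inr j) : MvPolynomial (I ⊕ J) k) •
                embX P₁ P₂ (word P₁ (lieElt x (x i₁) (x i₂))))) = 0
          rw [map_sub, map_add, map_smul, wordMap_embX, π_word, sub_eq_zero]
          simpa [wordMap] using hX i₁ i₂ j

lemma lift_toM (f : Gen I J P₁.G P₂.G →₀ MvPolynomial (I ⊕ J) k) :
    lift P₁ P₂ gA gB W hY hX (toM P₁ P₂ f) = wordMap P₁ P₂ gA gB W f := by
  refine (Module.Relations.Solution.fromQuotient_toQuotient (relations := relM P₁ P₂) _ f).trans ?_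
  exact LinearMap.congr_fun (Module.Relations.Solution.ofπ_π (relations := relM P₁ P₂) _ _) f

lemma lift_wM (i : I) (j : J) : lift P₁ P₂ gA gB W hY hX (wM P₁ P₂ i j) = W i j := by
  rw [wM, lift_toM]; simp [wordMap]

lemma lift_ιA (d : CommutantModule k x) :
    lift P₁ P₂ gA gB W hY hX (ιA P₁ P₂ d) = gA d := by
  obtain ⟨f, rfl⟩ := P₁.surjective_π d
  rw [← toM_embX, lift_toM, wordMap_embX]

lemma lift_ιB (d : CommutantModule k y) :
    lift P₁ P₂ gA gB W hY hX (ιB P₁ P₂ d) = gB d := by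
  obtain ⟨f, rfl⟩ := P₂.surjective_π d
  rw [← toM_embY, lift_toM, wordMap_embY]

end

variable [LinearOrder I] [LinearOrder J]

/-- This gives induction on `M` without reference to the generators of the presentations: the sets
`Z₁` and `Z₂` are absorbed into the images of `A²` and `B²`. -/
lemma span_eq_top : Submodule.span (MvPolynomial (I ⊕ J) k)
    (Set.range (ιA P₁ P₂) ∪ Set.range (ιB P₁ P₂) ∪
      Set.range fun p : I × J => wM P₁ P₂ p.1 p.2) = ⊤ := by
  rw [eq_top_iff]
  rintro m -
  obtain ⟨f, rfl⟩ : ∃ f, toM P₁ P₂ f = m := (relM P₁ P₂).surjective_toQuotient m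
  induction f using Finsupp.induction_linear with
  | zero => rw [map_zero]; exact Submodule.zero_mem _
  | add f g hf hg => rw [map_add]; exact Submodule.add_mem _ hf hg
  | single s a =>
    rw [toM_single]
    refine Submodule.smul_mem _ _ (Submodule.subset_span ?_)
    cases s with
    | w i j => exact .inr ⟨(i, j), rfl⟩
    | z₁ g => exact .inl (.inl ⟨_, ιA_var P₁ P₂ g⟩)
    | z₂ g => exact .inl (.inr ⟨_, ιB_var P₁ P₂ g⟩)

end ModM

end ModuleM

/-! ### Extensions of ideals generated by variables -/

section Koszul

variable {k σ ι : Type*} [Field k] (f : ι → σ) (hf : Function.Injective f)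
  {Q : Type*} [AddCommGroup Q] [Module (MvPolynomial σ k) Q]

open MvPolynomial

lemma monomial_add_single (α : σ →₀ ℕ) (s : σ) (c : k) :
    monomial (α + Finsupp.single s 1) c = monomial α c * X s := by
  rw [X, monomial_mul, mul_one]

/-- An additive map on polynomials with prescribed values `c • g α` at the monomials. -/
lemma exists_addMonoidHom_monomial (g : (σ →₀ ℕ) → Q) :
    ∃ t : MvPolynomial σ k →+ Q, ∀ α c, t (monomial α c) = (C c : MvPolynomial σ k) • g α := by
  -- Over `k` the monomials form a basis, so their images may be prescribed freely; the price is
  -- that the map is not linear over the polynomial ring.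
  let _ : Module k Q := Module.compHom Q (C : k →+* MvPolynomial σ k)
  refine ⟨((basisMonomials σ k).constr k g).toAddMonoidHom, fun α c => ?_⟩
  have h : monomial α c = c • basisMonomials σ k α := by
    rw [coe_basisMonomials, smul_monomial, smul_eq_mul, mul_one]
  change (basisMonomials σ k).constr k g (monomial α c) = _
  rw [h, map_smul, Module.Basis.constr_basis]
  rfl

include hf in
/-- If `β` is an alternating map satisfying the Jacobi identity, the syzygies
`X_b e_a - X_a e_b` of the variables can be mapped to `β a b` by an additive map that respects
multiples of these syzygies. -/
lemma exists_syzygy_section [LinearOrder ι] (β : ι → ι → Q) (hβ : ∀ a, β a a = 0)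
    (hswap : ∀ a b, β a b = - β b a)
    (hjac : ∀ a b c, (X (f c) : MvPolynomial σ k) • β a b + (X (f a) : MvPolynomial σ k) • β b c +
      (X (f b) : MvPolynomial σ k) • β c a = 0) :
    ∃ s : (ι →₀ MvPolynomial σ k) →+ Q, ∀ (r : MvPolynomial σ k) (a b : ι),
      s (Finsupp.single a (r * X (f b))) - s (Finsupp.single b (r * X (f a))) = r • β a b := by
  classical
  -- `S α` collects the indices in `ι` whose variables divide the monomial `α`; the other variables
  -- of `σ` act as mere coefficients. For `α e_a`, `top` is the largest index among `a` and `S α`,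
  -- and `s` exchanges it with `a`, producing `(α / X_top) • β a top`.
  let S : (σ →₀ ℕ) → Finset ι := fun α => α.support.preimage f hf.injOn
  let top : (σ →₀ ℕ) → ι → ι := fun α a => (insert a (S α)).max' ⟨a, Finset.mem_insert_self _ _⟩
  -- If the top index is not in `S α`, the subtraction of exponents is truncated. The top index is
  -- then `a` itself and `β a a = 0`, so the value is still the right one.
  choose t ht using fun a : ι => exists_addMonoidHom_monomial (k := k) fun α =>
    (monomial (α - Finsupp.single (f (top α a)) 1) 1 : MvPolynomial σ k) • β a (top α a)
  have ht' : ∀ a α c, t a (monomial α c) =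
      (monomial (α - Finsupp.single (f (top α a)) 1) c : MvPolynomial σ k) • β a (top α a) := by
    intro a α c
    rw [ht, smul_smul, C_mul_monomial, mul_one]
  refine ⟨Finsupp.liftAddHom t, fun r a b => ?_⟩
  rw [Finsupp.liftAddHom_apply_single, Finsupp.liftAddHom_apply_single]
  induction r using MvPolynomial.induction_on' with
  | add p q hp hq =>
    rw [add_smul, ← hp, ← hq, add_mul, add_mul, map_add, map_add]; abel
  | monomial α c =>
    have hS : ∀ b, S (α + Finsupp.single (f b) 1) = insert b (S α) := by
      intro b
      ext i
      simp only [S, Finset.mem_preimage, Finsupp.mem_support_iff, Finset.mem_insert,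
        Finsupp.add_apply, Finsupp.single_apply, hf.eq_iff]
      by_cases h : b = i
      · simp [h]
      · simp [h, Ne.symm h]
    -- The two terms `α X_b e_a` and `α X_a e_b` involve the same set of indices, `a`, `b` and `S
    -- α`, hence have the same top index `T`.
    obtain ⟨T, h₁, h₂, hT⟩ : ∃ T, top (α + Finsupp.single (f b) 1) a = T ∧
        top (α + Finsupp.single (f a) 1) b = T ∧ (T = a ∨ T = b ∨ T ∈ S α) := by
      refine ⟨_, rfl, ?_, ?_⟩
      · simp only [top, hS, Finset.insert_comm a b]
      · have := Finset.max'_mem (insert a (S (α + Finsupp.single (f b) 1)))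
          ⟨a, Finset.mem_insert_self _ _⟩
        simpa only [top, Finset.mem_insert, hS] using this
    rw [← monomial_add_single, ← monomial_add_single, ht', ht', h₁, h₂]
    -- When `T` is `a` or `b`, one term vanishes and the other is the required value, by
    -- antisymmetry in the first case. Otherwise `X_T` divides `α`, and the Jacobi identity for `a`,
    -- `b`, `T` closes the gap.
    rcases hT with rfl | rfl | hT
    · rw [hβ, smul_zero, zero_sub, add_tsub_cancel_right, hswap b, smul_neg, neg_neg]
    · rw [hβ, smul_zero, sub_zero, add_tsub_cancel_right]
    · obtain ⟨α, rfl⟩ : ∃ α', α = α' + Finsupp.single (f T) 1 := by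
        refine ⟨α - Finsupp.single (f T) 1, (tsub_add_cancel_of_le ?_).symm⟩
        rw [Finsupp.single_le_iff, Nat.one_le_iff_ne_zero]
        simpa [S] using hT
      rw [add_right_comm, add_tsub_cancel_right, add_right_comm, add_tsub_cancel_right,
        monomial_add_single, monomial_add_single, monomial_add_single]
      have h := hjac a b T
      rw [hswap T a, smul_neg] at h
      linear_combination (norm := module) (-monomial α c : MvPolynomial σ k) • h

variable (k)

/-- The submodule of `Q ⊕ F`, for `F` the free module on `ι`, that identifies `β a b` in `Q` with
the syzygy `X_b e_a - X_a e_b`. -/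
def syzygyGraph (β : ι → ι → Q) :
    Submodule (MvPolynomial σ k) (Q × (ι →₀ MvPolynomial σ k)) :=
  Submodule.span _ (Set.range fun p : ι × ι =>
    (β p.1 p.2, Finsupp.single p.2 (X (f p.1)) - Finsupp.single p.1 (X (f p.2))))

/-- The extension by `Q` of the ideal generated by the variables with indices in `ι` that is
determined by `β`. -/
abbrev SyzygyExt (β : ι → ι → Q) : Type _ := (Q × (ι →₀ MvPolynomial σ k)) ⧸ syzygyGraph k f β

/-- The inclusion of `Q` in the extension. -/
def SyzygyExt.inl (β : ι → ι → Q) : Q →ₗ[MvPolynomial σ k] SyzygyExt k f β :=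
  (syzygyGraph k f β).mkQ ∘ₗ LinearMap.inl _ _ _

/-- The generators of the extension. -/
def SyzygyExt.gen (β : ι → ι → Q) (a : ι) : SyzygyExt k f β :=
  (syzygyGraph k f β).mkQ (0, Finsupp.single a 1)

/-- Multiplied by a variable outside the image of `f`, this becomes the relation that `M` imposes on
the `w_ij`; it is what makes the maps from `M` to the extension well defined. -/
lemma SyzygyExt.X_smul_gen (β : ι → ι → Q) (a b : ι) :
    (X (f b) : MvPolynomial σ k) • SyzygyExt.gen k f β a =
      (X (f a) : MvPolynomial σ k) • SyzygyExt.gen k f β b + SyzygyExt.inl k f β (β a b) := by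
  rw [SyzygyExt.gen, SyzygyExt.gen, SyzygyExt.inl, ← map_smul, ← map_smul,
    LinearMap.comp_apply, ← map_add, eq_comm, ← sub_eq_zero, ← map_sub, Submodule.mkQ_apply, Submodule.Quotient.mk_eq_zero]
  refine Submodule.subset_span ⟨(a, b), ?_⟩
  ext1 <;> simp

-- With `s` from `exists_syzygy_section`, the additive map `(q, v) ↦ q + s v` vanishes on the
-- submodule being divided out and is the identity on `Q`, so no nonzero element of `Q` is killed.
include hf in
lemma SyzygyExt.inl_injective [LinearOrder ι] (β : ι → ι → Q) (hβ : ∀ a, β a a = 0)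
    (hswap : ∀ a b, β a b = - β b a)
    (hjac : ∀ a b c, (X (f c) : MvPolynomial σ k) • β a b + (X (f a) : MvPolynomial σ k) • β b c +
      (X (f b) : MvPolynomial σ k) • β c a = 0) :
    Function.Injective (SyzygyExt.inl k f β) := by
  obtain ⟨s, hs⟩ := exists_syzygy_section f hf β hβ hswap hjac
  rw [injective_iff_map_eq_zero]
  intro q hq
  have hq : (q, (0 : ι →₀ MvPolynomial σ k)) ∈ syzygyGraph k f β :=
    (Submodule.Quotient.mk_eq_zero _).mp hq
  have key : ∀ p ∈ syzygyGraph k f β, p.1 + s p.2 = 0 := by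
    intro p hp
    -- Since `s` is only additive, the vanishing must be proved for all multiples at once; otherwise
    -- the induction over the span fails at scalar multiplication.
    suffices h : ∀ r : MvPolynomial σ k, r • p.1 + s (r • p.2) = 0 by simpa using h 1
    refine Submodule.span_induction (p := fun p _ => ∀ r : MvPolynomial σ k,
      r • p.1 + s (r • p.2) = 0) ?_ ?_ ?_ ?_ hp
    · rintro _ ⟨⟨a, b⟩, rfl⟩ r
      simp only [smul_sub, Finsupp.smul_single, smul_eq_mul, map_sub]
      rw [← hs r a b]; abel
    · simp
    · intro p q _ _ hp hq r
      rw [Prod.fst_add, Prod.snd_add, smul_add, smul_add, map_add, add_add_add_comm, hp, hq,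
        add_zero]
    · intro c p _ hp r
      rw [Prod.smul_fst, Prod.smul_snd, smul_smul, smul_smul]
      exact hp _
  simpa using key _ hq

end Koszul

/-! ### The ideal generated by the products of two disjoint sets of variables -/

section Ideal

open MvPolynomial

variable {k I J : Type*} [Field k] {Q : Type*} [AddCommGroup Q]
  [Module (MvPolynomial (I ⊕ J) k) Q]

/-- The ideal generated by the `x_i y_j` is presented by the generators `w_ij` with the relations
`w_ij' y_j = w_ij y_j'` and `w_i'j x_i = w_ij x_i'`. -/
lemma exists_addMonoidHom_mul_X_mul_X (W : I → J → Q)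
    (hX : ∀ a b j, (X (Sum.inl b) : MvPolynomial (I ⊕ J) k) • W a j =
      (X (Sum.inl a) : MvPolynomial (I ⊕ J) k) • W b j)
    (hY : ∀ i a b, (X (Sum.inr b) : MvPolynomial (I ⊕ J) k) • W i a =
      (X (Sum.inr a) : MvPolynomial (I ⊕ J) k) • W i b) :
    ∃ t : MvPolynomial (I ⊕ J) k →+ Q, ∀ r i j,
      t (r * (X (Sum.inl i) * X (Sum.inr j))) = r • W i j := by
  classical
  -- The value at `α` must not depend on which factor `x_i y_j` is split off. Monomials without such
  -- a factor receive the value `0`.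
  have ex : ∀ α : I ⊕ J →₀ ℕ, ∃ q : Q, ∀ (α' : I ⊕ J →₀ ℕ) (i : I) (j : J),
      α = α' + Finsupp.single (Sum.inl i) 1 + Finsupp.single (Sum.inr j) 1 →
        q = (monomial α' 1 : MvPolynomial (I ⊕ J) k) • W i j := by
    intro α
    by_cases h : ∃ (α' : I ⊕ J →₀ ℕ) (i : I) (j : J),
      α = α' + Finsupp.single (Sum.inl i) 1 + Finsupp.single (Sum.inr j) 1
    · obtain ⟨μ, a, b, rfl⟩ := h
      refine ⟨(monomial μ 1 : MvPolynomial (I ⊕ J) k) • W a b, fun ν i j h => ?_⟩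
      -- Unique factorisation for monomials: if `δ X_s = ε X_t` with `s ≠ t`, then `X_t` divides `δ`
      -- and `X_s` divides `ε`, with the same cofactor.
      have step : ∀ (δ ε : I ⊕ J →₀ ℕ) (s t : I ⊕ J),
          δ + Finsupp.single s 1 = ε + Finsupp.single t 1 → s ≠ t →
          ∃ ζ, δ = ζ + Finsupp.single t 1 ∧ ε = ζ + Finsupp.single s 1 := by
        intro δ ε s t h hst
        have hle : Finsupp.single t 1 ≤ δ := by
          rw [Finsupp.single_le_iff]
          have := DFunLike.congr_fun h t
          simp [hst] at this
          omega
        refine ⟨δ - Finsupp.single t 1, (tsub_add_cancel_of_le hle).symm, ?_⟩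
        refine add_right_cancel (b := Finsupp.single t 1) ?_
        rw [← h, add_right_comm, tsub_add_cancel_of_le hle]
      by_cases hb : b = j
      · subst hb
        have h := add_right_cancel h
        by_cases ha : a = i
        · subst ha; rw [add_right_cancel h]
        · obtain ⟨ζ, rfl, rfl⟩ := step _ _ _ _ h (by simpa using ha)
          rw [monomial_add_single, monomial_add_single, mul_smul, mul_smul, hX]
      · obtain ⟨ζ, h₁, h₂⟩ := step _ _ _ _ h (by simpa using hb)
        obtain ⟨η, rfl, rfl⟩ := step _ _ _ _ h₁ (by simp)
        obtain ⟨η', h₃, rfl⟩ := step _ _ _ _ h₂.symm (by simp)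
        by_cases ha : a = i
        · subst ha
          obtain rfl := add_right_cancel h₃
          rw [monomial_add_single, monomial_add_single, mul_smul, mul_smul,
            hY]
        -- Both indices differ here, and the monomial is `θ x_a x_i y_b y_j`. The passage from `W a
        -- b` to `W i j` goes through `W a j`, by `hY` and then `hX`.
        · obtain ⟨θ, rfl, rfl⟩ := step _ _ _ _ h₃ (by simpa using ha)
          simp only [monomial_add_single, mul_smul]
          rw [hY, smul_comm (X (Sum.inl i) : MvPolynomial (I ⊕ J) k), hX, smul_comm, smul_smul,
            smul_smul, smul_smul, smul_smul]
          congr 1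
          ring
    · exact ⟨0, fun α' i j h' => absurd ⟨α', i, j, h'⟩ h⟩
  choose g hg using ex
  obtain ⟨t, ht⟩ := exists_addMonoidHom_monomial (k := k) g
  refine ⟨t, fun r i j => ?_⟩
  induction r using MvPolynomial.induction_on' with
  | add p q hp hq => rw [add_mul, map_add, hp, hq, add_smul]
  | monomial α c =>
    rw [← mul_assoc, ← monomial_add_single, ← monomial_add_single, ht, hg _ α i j rfl, smul_smul,
      C_mul_monomial, mul_one]

end Ideal

/-! ### The inverse of `ψ` -/

section CommutantMap

open MvPolynomial

variable {k L H ι τ : Type*} [Field k] [LieRing L] [LieAlgebra k L] [LieRing H] [LieAlgebra k H]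

lemma map_mem_commutant (φ : L →ₗ⁅k⁆ H) {a : L} (ha : a ∈ commutant k L) :
    φ a ∈ commutant k H := by
  refine commutant_induction (p := fun a => φ a ∈ commutant k H) ?_ ?_ ?_ ?_ ha
  · rw [map_zero]; exact zero_mem _
  · intro a b ha hb; rw [map_add]; exact add_mem ha hb
  · intro c a ha; rw [map_smul]; exact (commutant k H).smul_mem c ha
  · intro a b; rw [LieHom.map_lie]; exact lie_mem_commutant _ _

lemma CommutantModule.val_neg {z : ι → L} (d : CommutantModule k z) : (-d).val = - d.val := rfl

lemma CommutantModule.val_sub {z : ι → L} (d e : CommutantModule k z) :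
    (d - e).val = d.val - e.val := rfl

lemma CommutantModule.val_zero {z : ι → L} : (0 : CommutantModule k z).val = 0 := rfl

lemma CommutantModule.val_lieElt (z : ι → L) (a b : L) : (lieElt (k := k) z a b).val = ⁅a, b⁆ := rfl

variable [IsMetabelian L] [IsMetabelian H]

/-- The map of commutants induced by a homomorphism that sends a family `z` in `L` to a family
`z'` in `H` along `f`, semilinear along the renaming of variables. -/
def commutantMap (φ : L →ₗ⁅k⁆ H) (z : ι → L) (z' : τ → H) (f : ι → τ)
    (h : ∀ i, φ (z i) = z' (f i)) :
    CommutantModule k z →ₛₗ[(rename f : MvPolynomial ι k →ₐ[k] MvPolynomial τ k).toRingHom]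
      CommutantModule k z' where
  toFun d := .mk z' (φ d.val) (map_mem_commutant φ d.val_mem)
  map_add' d e := by
    ext
    exact map_add φ d.val e.val
  map_smul' r d := by
    change _ = rename f r • _
    induction r using MvPolynomial.induction_on generalizing d with
    | C c =>
      refine CommutantModule.ext ((congrArg φ (CommutantModule.val_C_smul c d)).trans ?_)
      rw [rename_C, CommutantModule.val_C_smul, map_smul]
      rfl
    | add p q hp hq =>
      rw [map_add, add_smul (rename f p), ← hp, ← hq]
      ext
      change φ ((p + q) • d).val = φ (p • d).val + φ (q • d).val
      rw [add_smul, CommutantModule.val_add, map_add]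
    | mul_X p i hp =>
      rw [mul_smul, hp, map_mul, mul_smul, rename_X]
      congr 1
      refine CommutantModule.ext ((congrArg φ (CommutantModule.val_X_smul i d)).trans ?_)
      rw [CommutantModule.val_X_smul, LieHom.map_lie, h]
      rfl

end CommutantMap

section Inverse

open MvPolynomial MetabelianProduct

variable {k A B I J : Type*} [Field k]
  [LieRing A] [LieAlgebra k A] [IsMetabelian A] [LieRing B] [LieAlgebra k B] [IsMetabelian B]
variable (X : LiftedBasis I k A) (Y : LiftedBasis J k B)

/-- The map `A² → (A ∗ B)²`. -/
def commA : CommutantModule k X.elt →ₛₗ[inclX k I J] CommutantModule k (genXY X Y) :=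
  commutantMap (inA k A B) X.elt (genXY X Y) Sum.inl fun _ => rfl

/-- The map `B² → (A ∗ B)²`. -/
def commB : CommutantModule k Y.elt →ₛₗ[inclY k I J] CommutantModule k (genXY X Y) :=
  commutantMap (inB k A B) Y.elt (genXY X Y) Sum.inr fun _ => rfl

lemma commA_val (d : CommutantModule k X.elt) : (commA X Y d).val = inA k A B d.val := rfl

lemma commB_val (d : CommutantModule k Y.elt) : (commB X Y d).val = inB k A B d.val := rfl

variable {X Y} in
lemma genXY_inl (i : I) : genXY X Y (Sum.inl i) = inA k A B (X.elt i) := rfl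

variable {X Y} in
lemma genXY_inr (j : J) : genXY X Y (Sum.inr j) = inB k A B (Y.elt j) := rfl

/-- The form of the Jacobi identity that matches both families of relations among the `w_ij`: take
`x_i`, `y_j₁`, `y_j₂` or `x_i₁`, `y_j`, `x_i₂`. -/
lemma lie_lie_comm {L : Type*} [LieRing L] (a b c : L) :
    ⁅⁅a, b⁆, c⁆ = ⁅⁅a, c⁆, b⁆ + ⁅⁅c, b⁆, a⁆ := by
  have h := lie_jacobi a b c
  rw [← lie_skew a, ← lie_skew b ⁅_, _⁆, ← lie_skew c ⁅_, _⁆] at h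
  rw [← lie_skew a c, ← lie_skew c b, neg_lie, neg_lie, ← sub_eq_zero, ← neg_eq_zero, ← h]
  abel

variable [LinearOrder I] [LinearOrder J]
variable {X Y}
variable (P₁ : Module.Presentation (MvPolynomial I k) (CommutantModule k X.elt))
  (P₂ : Module.Presentation (MvPolynomial J k) (CommutantModule k Y.elt))

/-- The natural map `M → (A ∗ B)²`. -/
def toComm : ModM P₁ P₂ →ₗ[MvPolynomial (I ⊕ J) k] CommutantModule k (genXY X Y) :=
  ModM.lift P₁ P₂ (commA X Y) (commB X Y)
    (fun i j => lieElt _ (inA k A B (X.elt i)) (inB k A B (Y.elt j)))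
    (fun i j₁ j₂ => by
      ext
      simp only [CommutantModule.val_add, CommutantModule.val_X_smul, commB_val,
        CommutantModule.val_lieElt, LieHom.map_lie, genXY_inl, genXY_inr]
      exact lie_lie_comm _ _ _)
    (fun i₁ i₂ j => by
      ext
      simp only [CommutantModule.val_add, CommutantModule.val_X_smul, commA_val,
        CommutantModule.val_lieElt, LieHom.map_lie, genXY_inl, genXY_inr]
      exact (lie_lie_comm _ _ _).trans (add_comm _ _))

lemma toComm_ιA (d : CommutantModule k X.elt) : toComm P₁ P₂ (ιA P₁ P₂ d) = commA X Y d :=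
  ModM.lift_ιA ..

lemma toComm_ιB (d : CommutantModule k Y.elt) : toComm P₁ P₂ (ιB P₁ P₂ d) = commB X Y d :=
  ModM.lift_ιB ..

lemma toComm_wM (i : I) (j : J) : toComm P₁ P₂ (wM P₁ P₂ i j) =
    lieElt _ (inA k A B (X.elt i)) (inB k A B (Y.elt j)) :=
  ModM.lift_wM ..

lemma val_toComm_smul (c : k) (m : ModM P₁ P₂) :
    (toComm P₁ P₂ (c • m)).val = c • (toComm P₁ P₂ m).val := by
  rw [← C_smul, map_smul, CommutantModule.val_C_smul]

lemma val_linForm_smul (v : I ⊕ J →₀ k) (d : CommutantModule k (genXY X Y)) :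
    (linForm k I J v • d).val = ⁅d.val, Finsupp.linearCombination k (genXY X Y) v⁆ := by
  induction v using Finsupp.induction_linear with
  | zero => rw [map_zero, map_zero, lie_zero, zero_smul]; rfl
  | add u v hu hv => rw [map_add, map_add, add_smul, lie_add, CommutantModule.val_add, hu, hv]
  | single s a =>
    rw [linForm_single, Finsupp.linearCombination_single, smul_eq_C_mul, mul_smul,
      CommutantModule.val_C_smul, CommutantModule.val_X_smul, lie_smul]

lemma val_toComm_basisMul (s t : I ⊕ J) :
    (toComm P₁ P₂ (basisMul P₁ P₂ s t)).val = ⁅genXY X Y s, genXY X Y t⁆ := by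
  rcases s with i | j <;> rcases t with i' | j' <;>
    simp only [basisMul, map_neg, toComm_ιA, toComm_ιB, toComm_wM, commA_val, commB_val,
      CommutantModule.val_neg, CommutantModule.val_lieElt, LieHom.map_lie, genXY_inl,
      genXY_inr, lie_skew]

lemma val_toComm_mulV (u v : I ⊕ J →₀ k) :
    (toComm P₁ P₂ (mulV P₁ P₂ u v)).val =
      ⁅Finsupp.linearCombination k (genXY X Y) u, Finsupp.linearCombination k (genXY X Y) v⁆ := by
  induction u using Finsupp.induction_linear with
  | zero => simp [CommutantModule.val_zero]
  | add u u' h h' =>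
    simp only [map_add, LinearMap.add_apply, add_lie, CommutantModule.val_add, h, h']
  | single s a =>
    induction v using Finsupp.induction_linear with
    | zero => simp [CommutantModule.val_zero]
    | add u u' h h' => simp only [map_add, lie_add, CommutantModule.val_add, h, h']
    | single t b =>
      rw [mulV_single, val_toComm_smul, val_toComm_smul, val_toComm_basisMul,
        Finsupp.linearCombination_single, Finsupp.linearCombination_single, smul_lie, lie_smul]

/-- The inverse of `ψ`. -/
def psiInv : AlgC P₁ P₂ →ₗ⁅k⁆ MetabelianProduct k A B where
  toFun c := Finsupp.linearCombination k (genXY X Y) c.v + (toComm P₁ P₂ c.m).val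
  map_add' c d := by
    rw [AlgC.v_add, AlgC.m_add, map_add, map_add, CommutantModule.val_add]; abel
  map_smul' a c := by
    rw [AlgC.v_smul, AlgC.m_smul, map_smul, val_toComm_smul, RingHom.id_apply, smul_add]
  map_lie' {c d} := by
    change Finsupp.linearCombination k (genXY X Y) ⁅c, d⁆.v + (toComm P₁ P₂ ⁅c, d⁆.m).val = _
    -- Of the four terms of the expanded bracket, this is the one absent from the product of `C`; it
    -- vanishes because `A ∗ B` is metabelian.
    have h : ⁅(toComm P₁ P₂ c.m).val, (toComm P₁ P₂ d.m).val⁆ = 0 :=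
      lie_eq_zero_of_mem_commutant (CommutantModule.val_mem _) (CommutantModule.val_mem _)
    rw [AlgC.v_lie, AlgC.m_lie, map_zero, zero_add, map_add, map_sub, map_smul, map_smul,
      CommutantModule.val_add, CommutantModule.val_sub, val_linForm_smul, val_linForm_smul,
      val_toComm_mulV, add_lie, lie_add, lie_add, h, add_zero,
      ← lie_skew (Finsupp.linearCombination k (genXY X Y) c.v) (toComm P₁ P₂ d.m).val,
      sub_eq_add_neg]

lemma psiInv_apply (c : AlgC P₁ P₂) : psiInv P₁ P₂ c =
    Finsupp.linearCombination k (genXY X Y) c.v + (toComm P₁ P₂ c.m).val := rfl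

lemma psi_inA (a : A) : psi P₁ P₂ (inA k A B a) = toCA P₁ P₂ a := lift_inA _ _ a

lemma psi_inB (b : B) : psi P₁ P₂ (inB k A B b) = toCB P₁ P₂ b := lift_inB _ _ b

lemma toCA_apply (a : A) :
    toCA P₁ P₂ a = AlgC.mk ((X.coord a).mapDomain Sum.inl) (ιA P₁ P₂ (X.rest a)) := rfl

lemma toCB_apply (b : B) :
    toCB P₁ P₂ b = AlgC.mk ((Y.coord b).mapDomain Sum.inr) (ιB P₁ P₂ (Y.rest b)) := rfl

lemma linearCombination_genXY_inl (v : I →₀ k) :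
    Finsupp.linearCombination k (genXY X Y) (v.mapDomain Sum.inl) = inA k A B (X.comb v) := by
  rw [Finsupp.linearCombination_mapDomain, LiftedBasis.comb]
  exact (Finsupp.apply_linearCombination k (inA k A B : A →ₗ[k] MetabelianProduct k A B) X.elt v).symm

lemma linearCombination_genXY_inr (v : J →₀ k) :
    Finsupp.linearCombination k (genXY X Y) (v.mapDomain Sum.inr) = inB k A B (Y.comb v) := by
  rw [Finsupp.linearCombination_mapDomain, LiftedBasis.comb]
  exact (Finsupp.apply_linearCombination k (inB k A B : B →ₗ[k] MetabelianProduct k A B) Y.elt v).symm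

/-- By the uniqueness in the universal property only elements of `A` and `B` matter, and there the
claim is the decomposition of an element into `comb (coord a)` and `rest a`. -/
lemma psiInv_psi (p : MetabelianProduct k A B) : psiInv P₁ P₂ (psi P₁ P₂ p) = p := by
  have h : (psiInv P₁ P₂).comp (psi P₁ P₂) = LieHom.id := by
    refine MetabelianProduct.hom_ext (fun a => ?_) (fun b => ?_)
    · rw [LieHom.comp_apply, psi_inA, toCA_apply, psiInv_apply, AlgC.v_mk, AlgC.m_mk, toComm_ιA,
        commA_val, linearCombination_genXY_inl, X.val_rest, ← map_add, add_sub_cancel]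
      rfl
    · rw [LieHom.comp_apply, psi_inB, toCB_apply, psiInv_apply, AlgC.v_mk, AlgC.m_mk, toComm_ιB,
        commB_val, linearCombination_genXY_inr, Y.val_rest, ← map_add, add_sub_cancel]
      rfl
  exact LieHom.congr_fun h p

lemma psi_genXY (s : I ⊕ J) :
    psi P₁ P₂ (genXY X Y s) = AlgC.mk (Finsupp.single s 1) 0 := by
  have hX : ∀ i, X.comb (Finsupp.single i 1) = X.elt i := fun i => by simp [LiftedBasis.comb]
  have hY : ∀ i, Y.comb (Finsupp.single i 1) = Y.elt i := fun i => by simp [LiftedBasis.comb]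
  have hX' : ∀ i, X.rest (X.elt i) = 0 := fun i => by
    ext
    rw [X.val_rest, ← hX, X.coord_comb, sub_self]; rfl
  have hY' : ∀ i, Y.rest (Y.elt i) = 0 := fun i => by
    ext
    rw [Y.val_rest, ← hY, Y.coord_comb, sub_self]; rfl
  rcases s with i | j
  · rw [genXY, Sum.elim_inl, psi_inA, toCA_apply, hX', map_zero, ← hX, X.coord_comb,
      Finsupp.mapDomain_single]
  · rw [genXY, Sum.elim_inr, psi_inB, toCB_apply, hY', map_zero, ← hY, Y.coord_comb,
      Finsupp.mapDomain_single]

lemma AlgC.mk_lie_mk_zero (m : ModM P₁ P₂) (s : I ⊕ J) :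
    ⁅AlgC.mk 0 m, AlgC.mk (Finsupp.single s (1 : k)) 0⁆ =
      AlgC.mk 0 ((MvPolynomial.X s : MvPolynomial (I ⊕ J) k) • m) := by
  ext1
  · rfl
  · rw [AlgC.m_lie, AlgC.m_mk, AlgC.m_mk, AlgC.v_mk, AlgC.v_mk, map_zero, linForm_single, one_smul,
      smul_zero, sub_zero, AlgC.m_mk, LinearMap.zero_apply, zero_add]

/-- Induction over the generators of `M` works because a variable acts on `(A ∗ B)²` as bracketing
with an element of `X ∪ Y`, and `psi` turns this into bracketing with a basis vector of `V`, which
is multiplication by the same variable on `M`. -/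
lemma psi_toComm (m : ModM P₁ P₂) : psi P₁ P₂ (toComm P₁ P₂ m).val = AlgC.mk 0 m := by
  have hm : m ∈ Submodule.span (MvPolynomial (I ⊕ J) k)
    (Set.range (ιA P₁ P₂) ∪ Set.range (ιB P₁ P₂) ∪
      Set.range fun p : I × J => wM P₁ P₂ p.1 p.2) := by
    rw [ModM.span_eq_top]; exact Submodule.mem_top
  induction hm using Submodule.span_induction with
  | zero => rw [map_zero, CommutantModule.val_zero, map_zero]; rfl
  | add m n _ _ hm hn =>
    rw [map_add, CommutantModule.val_add, map_add, hm, hn]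
    ext1
    · exact add_zero _
    · rfl
  | smul r m _ hm =>
    induction r using MvPolynomial.induction_on with
    | C c =>
      rw [C_smul, val_toComm_smul, map_smul, hm]
      ext1
      · exact smul_zero _
      · rfl
    | add p q hp hq =>
      rw [add_smul, map_add, CommutantModule.val_add, map_add, hp, hq]
      ext1
      · exact add_zero _
      · rfl
    | mul_X p s hp =>
      rw [mul_comm, mul_smul, map_smul, CommutantModule.val_X_smul, LieHom.map_lie, hp, psi_genXY,
        AlgC.mk_lie_mk_zero]
  | mem m hm =>
    rcases hm with (⟨d, rfl⟩ | ⟨d, rfl⟩) | ⟨⟨i, j⟩, rfl⟩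
    · rw [toComm_ιA, commA_val, psi_inA, toCA_apply, X.coord_eq_zero d.val_mem,
        Finsupp.mapDomain_zero]
      congr 2
      ext
      rw [X.val_rest, X.coord_eq_zero d.val_mem, map_zero, sub_zero]
    · rw [toComm_ιB, commB_val, psi_inB, toCB_apply, Y.coord_eq_zero d.val_mem,
        Finsupp.mapDomain_zero]
      congr 2
      ext
      rw [Y.val_rest, Y.coord_eq_zero d.val_mem, map_zero, sub_zero]
    · rw [toComm_wM, CommutantModule.val_lieElt, LieHom.map_lie]
      change ⁅psi P₁ P₂ (genXY X Y (Sum.inl i)), psi P₁ P₂ (genXY X Y (Sum.inr j))⁆ = _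
      rw [psi_genXY, psi_genXY]
      ext1
      · rfl
      · rw [AlgC.m_lie]
        simp only [AlgC.v_mk, AlgC.m_mk, smul_zero, sub_zero, add_zero, mulV_single, one_smul]
        rfl

lemma psi_psiInv (c : AlgC P₁ P₂) : psi P₁ P₂ (psiInv P₁ P₂ c) = c := by
  have h : ∀ v, psi P₁ P₂ (Finsupp.linearCombination k (genXY X Y) v) = AlgC.mk v 0 := by
    intro v
    induction v using Finsupp.induction_linear with
    | zero => rw [map_zero, map_zero]; rfl
    | add u v hu hv =>
      rw [map_add, map_add, hu, hv]
      ext1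
      · rfl
      · exact add_zero _
    | single s a =>
      rw [Finsupp.linearCombination_single, map_smul, psi_genXY]
      ext1
      · rw [AlgC.v_smul, AlgC.v_mk, AlgC.v_mk, Finsupp.smul_single, smul_eq_mul, mul_one]
      · exact smul_zero _
  rw [psiInv_apply, map_add, h, psi_toComm]
  ext1
  · exact add_zero _
  · exact zero_add _

lemma psi_bijective : Function.Bijective (psi P₁ P₂) :=
  Function.bijective_iff_has_inverse.mpr ⟨psiInv P₁ P₂, psiInv_psi P₁ P₂, psi_psiInv P₁ P₂⟩

lemma psi_v_eq_zero {p : MetabelianProduct k A B} (hp : p ∈ commutant k (MetabelianProduct k A B)) :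
    (psi P₁ P₂ p).v = 0 := by
  refine commutant_induction (p := fun p => (psi P₁ P₂ p).v = 0) ?_ ?_ ?_ ?_ hp
  · rw [map_zero]; rfl
  · intro a b ha hb; rw [map_add, AlgC.v_add, ha, hb, add_zero]
  · intro c a ha; rw [map_smul, AlgC.v_smul, ha, smul_zero]
  · intro a b; rw [LieHom.map_lie, AlgC.v_lie]

/-- The map `psi` recovers `m` from `toComm m`. Conversely `psi` sends an element of the commutant
to some `(0, m)`, and injectivity of `psi` shows that the element is `toComm m`. -/
lemma toComm_bijective : Function.Bijective (toComm P₁ P₂) := by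
  constructor
  · intro m n h
    have h' := psi_toComm P₁ P₂ m
    rw [h, psi_toComm] at h'
    exact (congrArg AlgC.m h').symm
  · intro d
    refine ⟨(psi P₁ P₂ d.val).m, CommutantModule.ext ((psi_bijective P₁ P₂).1 ?_)⟩
    rw [psi_toComm]
    exact AlgC.ext (psi_v_eq_zero P₁ P₂ d.val_mem).symm rfl

/-- The isomorphism of `(A ∗ B)²` with `M`. -/
def commEquiv : CommutantModule k (genXY X Y) ≃ₗ[MvPolynomial (I ⊕ J) k] ModM P₁ P₂ :=
  (LinearEquiv.ofBijective _ (toComm_bijective P₁ P₂)).symm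

lemma toComm_commEquiv (d : CommutantModule k (genXY X Y)) :
    toComm P₁ P₂ (commEquiv P₁ P₂ d) = d :=
  (LinearEquiv.ofBijective _ (toComm_bijective P₁ P₂)).apply_symm_apply d

lemma commEquiv_toComm (m : ModM P₁ P₂) : commEquiv P₁ P₂ (toComm P₁ P₂ m) = m :=
  (LinearEquiv.ofBijective _ (toComm_bijective P₁ P₂)).symm_apply_apply m

lemma psi_val (d : CommutantModule k (genXY X Y)) :
    psi P₁ P₂ d.val = AlgC.mk 0 (commEquiv P₁ P₂ d) := by
  rw [← psi_toComm, toComm_commEquiv]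

lemma psi_image_commutant :
    psi P₁ P₂ '' (commutant k (MetabelianProduct k A B) : Set (MetabelianProduct k A B)) =
      (UC P₁ P₂ : Set (AlgC P₁ P₂)) := by
  apply Set.Subset.antisymm
  · rintro _ ⟨p, hp, rfl⟩
    exact psi_v_eq_zero P₁ P₂ hp
  · intro c hc
    have hc : c.v = 0 := hc
    refine ⟨(toComm P₁ P₂ c.m).val, CommutantModule.val_mem _, ?_⟩
    rw [psi_toComm]
    exact AlgC.ext hc.symm rfl

end Inverse

/-! ### The structure of `M` -/

section Structure

open MvPolynomial MetabelianProduct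

variable {k A B I J : Type*} [Field k]
  [LieRing A] [LieAlgebra k A] [IsMetabelian A] [LieRing B] [LieAlgebra k B] [IsMetabelian B]
  [LinearOrder I] [LinearOrder J]
variable {X : LiftedBasis I k A} {Y : LiftedBasis J k B}
variable (P₁ : Module.Presentation (MvPolynomial I k) (CommutantModule k X.elt))
  (P₂ : Module.Presentation (MvPolynomial J k) (CommutantModule k Y.elt))

/-- The natural map `M₁ → M`. -/
def incA : M₁ X J →ₗ[MvPolynomial (I ⊕ J) k] ModM P₁ P₂ := ExtendScalars.lift (ιA P₁ P₂)

/-- The natural map `M₂ → M`. -/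
def incB : M₂ I Y →ₗ[MvPolynomial (I ⊕ J) k] ModM P₁ P₂ := ExtendScalars.lift (ιB P₁ P₂)

lemma incA_of (d : CommutantModule k X.elt) :
    incA P₁ P₂ (ExtendScalars.of (inclX k I J) d) = ιA P₁ P₂ d :=
  ExtendScalars.lift_of _ _

lemma incB_of (d : CommutantModule k Y.elt) :
    incB P₁ P₂ (ExtendScalars.of (inclY k I J) d) = ιB P₁ P₂ d :=
  ExtendScalars.lift_of _ _

/-- After extension of scalars along a renaming of variables, the products of the elements of a
family satisfy the hypotheses of `SyzygyExt.inl_injective`. -/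
lemma extendScalars_lieElt_inl_injective {L ι σ : Type*} [LieRing L] [LieAlgebra k L]
    [IsMetabelian L] [LinearOrder ι] (z : ι → L) (f : ι → σ) (hf : Function.Injective f) :
    Function.Injective (SyzygyExt.inl k f fun a b : ι =>
      ExtendScalars.ofₛₗ (rename f : MvPolynomial ι k →ₐ[k] MvPolynomial σ k).toRingHom
        (CommutantModule k z) (lieElt z (z a) (z b))) := by
  refine SyzygyExt.inl_injective k f hf _ (fun a => ?_) (fun a b => ?_) fun a b c => ?_
  · rw [lieElt_self, map_zero]
  · rw [lieElt_swap, map_neg]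
  -- Moving the variables inside the tensor product reduces the hypothesis to the Jacobi identity in
  -- `L`.
  · have e : ∀ c d, ExtendScalars.ofₛₗ
        (rename f : MvPolynomial ι k →ₐ[k] MvPolynomial σ k).toRingHom (CommutantModule k z)
        ((MvPolynomial.X c : MvPolynomial ι k) • d) =
          (MvPolynomial.X (f c) : MvPolynomial σ k) • ExtendScalars.ofₛₗ _ _ d := fun c d =>
      (map_smulₛₗ _ _ _).trans (congrArg (· • _) (rename_X f c))
    rw [← e, ← e, ← e, ← map_add, ← map_add, jacobi_lieElt, map_zero]

/-- A map from `M` that is zero on `M₂` and the embedding `SyzygyExt.inl` on `M₁` forces `m = 0`;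
the mirror image forces `n = 0`. Injectivity of both inclusions and directness of the sum all
follow. -/
lemma eq_zero_of_incA_add_incB_eq_zero {m : M₁ X J} {n : M₂ I Y}
    (h : incA P₁ P₂ m + incB P₁ P₂ n = 0) : m = 0 ∧ n = 0 := by
  constructor
  · let β : I → I → M₁ X J := fun a b =>
      ExtendScalars.ofₛₗ (inclX k I J) _ (lieElt X.elt (X.elt a) (X.elt b))
    let p : ModM P₁ P₂ →ₗ[MvPolynomial (I ⊕ J) k] SyzygyExt k Sum.inl β :=
      ModM.lift P₁ P₂ ((SyzygyExt.inl k Sum.inl β).comp (ExtendScalars.ofₛₗ (inclX k I J) _)) 0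
        (fun i j => (MvPolynomial.X (Sum.inr j) : MvPolynomial (I ⊕ J) k) •
          SyzygyExt.gen k Sum.inl β i)
        (fun i j₁ j₂ => by rw [LinearMap.zero_apply, smul_zero, add_zero, smul_comm])
        (fun i₁ i₂ j => by
          rw [smul_comm, SyzygyExt.X_smul_gen, smul_add, smul_comm]
          rfl)
    have hA : p ∘ₗ incA P₁ P₂ = SyzygyExt.inl k Sum.inl β := ExtendScalars.hom_ext fun d => by
      rw [LinearMap.comp_apply, incA_of, ModM.lift_ιA]; rfl
    have hB : p ∘ₗ incB P₁ P₂ = 0 := ExtendScalars.hom_ext fun d => by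
      rw [LinearMap.comp_apply, incB_of, ModM.lift_ιB]; rfl
    have h' := congrArg p h
    rw [map_add, ← LinearMap.comp_apply, ← LinearMap.comp_apply, hA, hB, LinearMap.zero_apply,
      add_zero, map_zero] at h'
    exact (injective_iff_map_eq_zero _).mp
      (extendScalars_lieElt_inl_injective X.elt Sum.inl Sum.inl_injective) m h'
  · let β : J → J → M₂ I Y := fun a b =>
      ExtendScalars.ofₛₗ (inclY k I J) _ (lieElt Y.elt (Y.elt a) (Y.elt b))
    let p : ModM P₁ P₂ →ₗ[MvPolynomial (I ⊕ J) k] SyzygyExt k Sum.inr β :=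
      ModM.lift P₁ P₂ 0 ((SyzygyExt.inl k Sum.inr β).comp (ExtendScalars.ofₛₗ (inclY k I J) _))
        -- The sign accounts for the product of the `y`'s entering its relation as `y_j₂ y_j₁`, in
        -- the order opposite to that of the `x`'s.
        (fun i j => -((MvPolynomial.X (Sum.inl i) : MvPolynomial (I ⊕ J) k) •
          SyzygyExt.gen k Sum.inr β j))
        (fun i j₁ j₂ => by
          rw [smul_neg, smul_comm, SyzygyExt.X_smul_gen, smul_add, smul_comm, neg_add, smul_neg,
            ← smul_neg _ (SyzygyExt.inl k Sum.inr β _), ← map_neg, ← map_neg, ← lieElt_swap]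
          rfl)
        (fun i₁ i₂ j => by
          rw [LinearMap.zero_apply, smul_zero, add_zero, smul_neg, smul_neg, smul_comm])
    have hA : p ∘ₗ incA P₁ P₂ = 0 := ExtendScalars.hom_ext fun d => by
      rw [LinearMap.comp_apply, incA_of, ModM.lift_ιA]; rfl
    have hB : p ∘ₗ incB P₁ P₂ = SyzygyExt.inl k Sum.inr β := ExtendScalars.hom_ext fun d => by
      rw [LinearMap.comp_apply, incB_of, ModM.lift_ιB]; rfl
    have h' := congrArg p h
    rw [map_add, ← LinearMap.comp_apply, ← LinearMap.comp_apply, hA, hB, LinearMap.zero_apply,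
      zero_add, map_zero] at h'
    exact (injective_iff_map_eq_zero _).mp
      (extendScalars_lieElt_inl_injective Y.elt Sum.inr Sum.inr_injective) n h'

lemma incA_injective : Function.Injective (incA P₁ P₂) :=
  (injective_iff_map_eq_zero _).mpr fun m hm =>
    (eq_zero_of_incA_add_incB_eq_zero P₁ P₂ (n := 0) (by rw [hm, map_zero, add_zero])).1

lemma incB_injective : Function.Injective (incB P₁ P₂) :=
  (injective_iff_map_eq_zero _).mpr fun n hn =>
    (eq_zero_of_incA_add_incB_eq_zero P₁ P₂ (m := 0) (by rw [hn, map_zero, add_zero])).2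

lemma disjoint_range_incA_range_incB :
    Disjoint (LinearMap.range (incA P₁ P₂)) (LinearMap.range (incB P₁ P₂)) := by
  rw [Submodule.disjoint_def]
  rintro _ ⟨m, rfl⟩ ⟨n, hn⟩
  have h : incA P₁ P₂ m + incB P₁ P₂ (-n) = 0 := by rw [map_neg, hn, add_neg_cancel]
  rw [(eq_zero_of_incA_add_incB_eq_zero P₁ P₂ h).1, map_zero]

/-! ### The quotient of `M` by the images of `M₁` and `M₂`. -/

/-- The map `M → M₀` that sends `w_ij` to `x_i y_j` and `A²`, `B²` to zero. -/
def toM₀ : ModM P₁ P₂ →ₗ[MvPolynomial (I ⊕ J) k] M₀ k I J :=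
  ModM.lift P₁ P₂ 0 0
    (fun i j => ⟨MvPolynomial.X (Sum.inl i) * MvPolynomial.X (Sum.inr j), mem_M₀ k i j⟩)
    (fun i j₁ j₂ => by
      rw [LinearMap.zero_apply, smul_zero, add_zero]
      ext1
      simp only [SetLike.mk_smul_mk, smul_eq_mul]
      ring)
    (fun i₁ i₂ j => by
      rw [LinearMap.zero_apply, smul_zero, add_zero]
      ext1
      simp only [SetLike.mk_smul_mk, smul_eq_mul]
      ring)

lemma toM₀_ιA (d : CommutantModule k X.elt) : toM₀ P₁ P₂ (ιA P₁ P₂ d) = 0 := ModM.lift_ιA ..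

lemma toM₀_ιB (d : CommutantModule k Y.elt) : toM₀ P₁ P₂ (ιB P₁ P₂ d) = 0 := ModM.lift_ιB ..

lemma toM₀_wM (i : I) (j : J) : toM₀ P₁ P₂ (wM P₁ P₂ i j) =
    ⟨MvPolynomial.X (Sum.inl i) * MvPolynomial.X (Sum.inr j), mem_M₀ k i j⟩ := ModM.lift_wM ..

lemma toM₀_surjective : Function.Surjective (toM₀ P₁ P₂) := by
  have h : M₀ k I J ≤ (LinearMap.range (toM₀ P₁ P₂)).map (M₀ k I J).subtype := by
    refine Submodule.span_le.mpr ?_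
    rintro _ ⟨⟨i, j⟩, rfl⟩
    exact ⟨_, ⟨wM P₁ P₂ i j, rfl⟩, by rw [toM₀_wM]; rfl⟩
  intro p
  obtain ⟨_, ⟨m, rfl⟩, hm⟩ := h p.2
  exact ⟨m, Subtype.ext hm⟩

/-- Modulo `N` the relations of the `w_ij` lose their terms from `A²` and `B²`, so the class of `m`
can be recovered from its image in `M₀` by the additive map `t`; an element with zero image
therefore lies in `N`. -/
lemma ker_toM₀ : LinearMap.ker (toM₀ P₁ P₂) =
    LinearMap.range (incA P₁ P₂) ⊔ LinearMap.range (incB P₁ P₂) := by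
  set N := LinearMap.range (incA P₁ P₂) ⊔ LinearMap.range (incB P₁ P₂) with hN
  have hA : ∀ d, N.mkQ (ιA P₁ P₂ d) = 0 := fun d =>
    (Submodule.Quotient.mk_eq_zero _).mpr (Submodule.mem_sup_left ⟨_, incA_of P₁ P₂ d⟩)
  have hB : ∀ d, N.mkQ (ιB P₁ P₂ d) = 0 := fun d =>
    (Submodule.Quotient.mk_eq_zero _).mpr (Submodule.mem_sup_right ⟨_, incB_of P₁ P₂ d⟩)
  apply le_antisymm
  · obtain ⟨t, ht⟩ := exists_addMonoidHom_mul_X_mul_X (fun i j => N.mkQ (wM P₁ P₂ i j))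
      (fun a b j => by
        rw [← map_smul, wM_X_smul, map_add, map_smul, map_smul, hA, smul_zero, add_zero])
      (fun i a b => by
        rw [← map_smul, wM_Y_smul, map_add, map_smul, map_smul, hB, smul_zero, add_zero])
    -- The factor `r` again makes up for `t` being additive only.
    have key : ∀ (m : ModM P₁ P₂) (r : MvPolynomial (I ⊕ J) k),
        t (r * (toM₀ P₁ P₂ m).1) = r • N.mkQ m := by
      intro m
      have hm : m ∈ Submodule.span (MvPolynomial (I ⊕ J) k)
          (Set.range (ιA P₁ P₂) ∪ Set.range (ιB P₁ P₂) ∪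
            Set.range fun p : I × J => wM P₁ P₂ p.1 p.2) := by
        rw [ModM.span_eq_top]; exact Submodule.mem_top
      induction hm using Submodule.span_induction with
      | zero => intro r; simp
      | add m n _ _ hm hn =>
        intro r
        rw [map_add, map_add, smul_add, Submodule.coe_add, mul_add, map_add, hm, hn]
      | smul s m _ hm =>
        intro r
        rw [map_smul, map_smul, smul_smul, Submodule.coe_smul, smul_eq_mul, ← mul_assoc, hm]
      | mem m hm =>
        intro r
        rcases hm with (⟨d, rfl⟩ | ⟨d, rfl⟩) | ⟨⟨i, j⟩, rfl⟩
        · rw [toM₀_ιA, hA, smul_zero, Submodule.coe_zero, mul_zero, map_zero]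
        · rw [toM₀_ιB, hB, smul_zero, Submodule.coe_zero, mul_zero, map_zero]
        · rw [toM₀_wM, ht]
    intro m hm
    have h := key m 1
    rw [LinearMap.mem_ker.mp hm, Submodule.coe_zero, mul_zero, map_zero, one_smul] at h
    exact (Submodule.Quotient.mk_eq_zero _).mp h.symm
  · rw [hN, sup_le_iff, LinearMap.range_le_ker_iff, LinearMap.range_le_ker_iff]
    constructor
    · exact ExtendScalars.hom_ext fun d => by
        rw [LinearMap.comp_apply, incA_of, toM₀_ιA, LinearMap.zero_apply]
    · exact ExtendScalars.hom_ext fun d => by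
        rw [LinearMap.comp_apply, incB_of, toM₀_ιB, LinearMap.zero_apply]

/-! ### Transfer of the structure of `M` to the commutant of `A ∗ B`. -/

lemma map_toComm_range_incA :
    (LinearMap.range (incA P₁ P₂)).map (toComm P₁ P₂) = genByA X Y := by
  rw [incA, ExtendScalars.range_lift, Submodule.map_span, genByA, ← Set.range_comp]
  congr 1
  ext d
  constructor
  · rintro ⟨a, rfl⟩
    exact ⟨a.val, a.val_mem, by rw [Function.comp_apply, toComm_ιA, commA_val]⟩
  · rintro ⟨a, ha, hd⟩
    exact ⟨.mk _ a ha, by rw [Function.comp_apply, toComm_ιA]; exact CommutantModule.ext hd.symm⟩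

lemma map_toComm_range_incB :
    (LinearMap.range (incB P₁ P₂)).map (toComm P₁ P₂) = genByB X Y := by
  rw [incB, ExtendScalars.range_lift, Submodule.map_span, genByB, ← Set.range_comp]
  congr 1
  ext d
  constructor
  · rintro ⟨a, rfl⟩
    exact ⟨a.val, a.val_mem, by rw [Function.comp_apply, toComm_ιB, commB_val]⟩
  · rintro ⟨a, ha, hd⟩
    exact ⟨.mk _ a ha, by rw [Function.comp_apply, toComm_ιB]; exact CommutantModule.ext hd.symm⟩

/-- The isomorphism of `M₁` with the submodule of `(A ∗ B)²` generated by `A²`. -/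
def equivGenByA : M₁ X J ≃ₗ[MvPolynomial (I ⊕ J) k] genByA X Y :=
  (LinearEquiv.ofInjective (toComm P₁ P₂ ∘ₗ incA P₁ P₂)
    ((toComm_bijective P₁ P₂).1.comp (incA_injective P₁ P₂))).trans
    (LinearEquiv.ofEq _ _ (by rw [LinearMap.range_comp, map_toComm_range_incA]))

lemma equivGenByA_of (a : CommutantModule k X.elt) :
    (equivGenByA P₁ P₂ (ExtendScalars.of (inclX k I J) a)).1.val = inA k A B a.val := by
  change (toComm P₁ P₂ (incA P₁ P₂ (ExtendScalars.of (inclX k I J) a))).val = _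
  rw [incA_of, toComm_ιA, commA_val]

/-- The isomorphism of `M₂` with the submodule of `(A ∗ B)²` generated by `B²`. -/
def equivGenByB : M₂ I Y ≃ₗ[MvPolynomial (I ⊕ J) k] genByB X Y :=
  (LinearEquiv.ofInjective (toComm P₁ P₂ ∘ₗ incB P₁ P₂)
    ((toComm_bijective P₁ P₂).1.comp (incB_injective P₁ P₂))).trans
    (LinearEquiv.ofEq _ _ (by rw [LinearMap.range_comp, map_toComm_range_incB]))

lemma equivGenByB_of (b : CommutantModule k Y.elt) :
    (equivGenByB P₁ P₂ (ExtendScalars.of (inclY k I J) b)).1.val = inB k A B b.val := by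
  change (toComm P₁ P₂ (incB P₁ P₂ (ExtendScalars.of (inclY k I J) b))).val = _
  rw [incB_of, toComm_ιB, commB_val]

-- The statement concerns `A ∗ B` alone, but directness is established inside `M`, which is built
-- from presentations.
include P₁ P₂ in
lemma disjoint_genByA_genByB : Disjoint (genByA X Y) (genByB X Y) := by
  rw [← map_toComm_range_incA P₁ P₂, ← map_toComm_range_incB P₁ P₂]
  exact Submodule.disjoint_map (toComm_bijective P₁ P₂).1 (disjoint_range_incA_range_incB P₁ P₂)

lemma genByA_sup_genByB : genByA X Y ⊔ genByB X Y =
    LinearMap.ker (toM₀ P₁ P₂ ∘ₗ (commEquiv P₁ P₂).toLinearMap) := by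
  rw [← map_toComm_range_incA P₁ P₂, ← map_toComm_range_incB P₁ P₂, ← Submodule.map_sup,
    ← ker_toM₀, LinearMap.ker_comp]
  ext d
  constructor
  · rintro ⟨m, hm, rfl⟩
    rw [Submodule.mem_comap, LinearEquiv.coe_coe, commEquiv_toComm]
    exact hm
  · intro hd
    exact ⟨_, hd, toComm_commEquiv P₁ P₂ d⟩

/-- The isomorphism of the quotient of `(A ∗ B)²` by the submodules generated by `A²` and `B²`
with the ideal `M₀`. -/
def quotientEquivM₀ : (CommutantModule k (genXY X Y) ⧸ (genByA X Y ⊔ genByB X Y))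
    ≃ₗ[MvPolynomial (I ⊕ J) k] M₀ k I J :=
  (Submodule.quotEquivOfEq _ _ (genByA_sup_genByB P₁ P₂)).trans
    ((toM₀ P₁ P₂ ∘ₗ (commEquiv P₁ P₂).toLinearMap).quotKerEquivOfSurjective
      ((toM₀_surjective P₁ P₂).comp (commEquiv P₁ P₂).surjective))

lemma quotientEquivM₀_mk (i : I) (j : J) :
    quotientEquivM₀ P₁ P₂ (Submodule.Quotient.mk (lieElt (genXY X Y)
      (inA k A B (X.elt i)) (inB k A B (Y.elt j)))) =
      ⟨MvPolynomial.X (Sum.inl i) * MvPolynomial.X (Sum.inr j), mem_M₀ k i j⟩ := by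
  change toM₀ P₁ P₂ (commEquiv P₁ P₂ (lieElt (genXY X Y)
      (inA k A B (X.elt i)) (inB k A B (Y.elt j)))) = _
  rw [← toComm_wM P₁ P₂, commEquiv_toComm, toM₀_wM]

end Structure

end MetabelianLie

end

theorem theorem1 {k A B I J : Type*} [Field k]
    [LieRing A] [LieAlgebra k A] [IsMetabelian A]
    [LieRing B] [LieAlgebra k B] [IsMetabelian B]
    [LinearOrder I] [LinearOrder J]
    (X : LiftedBasis I k A) (Y : LiftedBasis J k B)
    (P₁ : Module.Presentation (MvPolynomial I k) (CommutantModule k X.elt))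
    (P₂ : Module.Presentation (MvPolynomial J k) (CommutantModule k Y.elt)) :
    -- `ψ : A ∗ B → C` is an isomorphism
    Function.Bijective (psi P₁ P₂) ∧
    -- `ψ` maps `(A ∗ B)²` onto `U(C)`
    psi P₁ P₂ '' (commutant k (MetabelianProduct k A B) : Set (MetabelianProduct k A B)) =
      (UC P₁ P₂ : Set (AlgC P₁ P₂)) ∧
    -- and identifies it with the module `M`
    (∃ e : CommutantModule k (genXY X Y) ≃ₗ[MvPolynomial (I ⊕ J) k] ModM P₁ P₂,
      ∀ d : CommutantModule k (genXY X Y), psi P₁ P₂ d.val = AlgC.mk 0 (e d)) ∧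
    -- `A²` generates a submodule isomorphic to `M₁`
    (∃ e₁ : M₁ X J ≃ₗ[MvPolynomial (I ⊕ J) k] genByA X Y,
      ∀ a : CommutantModule k X.elt,
        (e₁ (ExtendScalars.of (inclX k I J) a)).1.val = MetabelianProduct.inA k A B a.val) ∧
    -- `B²` generates a submodule isomorphic to `M₂`
    (∃ e₂ : M₂ I Y ≃ₗ[MvPolynomial (I ⊕ J) k] genByB X Y,
      ∀ b : CommutantModule k Y.elt,
        (e₂ (ExtendScalars.of (inclY k I J) b)).1.val = MetabelianProduct.inB k A B b.val) ∧
    -- the sum of these two submodules is direct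
    Disjoint (genByA X Y) (genByB X Y) ∧
    -- and the quotient by it is isomorphic to `M₀`
    ∃ e₀ : (CommutantModule k (genXY X Y) ⧸ (genByA X Y ⊔ genByB X Y))
        ≃ₗ[MvPolynomial (I ⊕ J) k] M₀ k I J,
      ∀ (i : I) (j : J),
        e₀ (Submodule.Quotient.mk (lieElt (genXY X Y)
          (MetabelianProduct.inA k A B (X.elt i)) (MetabelianProduct.inB k A B (Y.elt j)))) =
        ⟨MvPolynomial.X (Sum.inl i) * MvPolynomial.X (Sum.inr j), mem_M₀ k i j⟩ := by
  exact ⟨psi_bijective P₁ P₂, psi_image_commutant P₁ P₂, ⟨commEquiv P₁ P₂, psi_val P₁ P₂⟩,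
    ⟨equivGenByA P₁ P₂, equivGenByA_of P₁ P₂⟩, ⟨equivGenByB P₁ P₂, equivGenByB_of P₁ P₂⟩,
    disjoint_genByA_genByB P₁ P₂, quotientEquivM₀ P₁ P₂, quotientEquivM₀_mk P₁ P₂⟩
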